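/- Proposition 3.1 (local-global). Let $m\ge 2$, let $1\le k_1\le k_2\le\cdots\le k_m$ be integers, let $n=k_1+\cdots+k_m$, and write $\mathbf{k}=(k_1,\dots,k_m)$ and $k=k_1$. Let $i(n,\mathbf{k})$ be the proportion of permutations $\pi\in\mathcal{S}_n$ having pairwise disjoint fixed sets $A_1,\dots,A_m\subseteq\{1,\dots,n\}$ (that is, $\pi(A_i)=A_i$) with $|A_i|=k_i$ for each $i$. For a tuple $\mathbf{c}=(c_1,\dots,c_k)$ of nonnegative integers, let $\mathscr{L}_m(\mathbf{c})$ be the (finite) set of all $m$-tuples $$\Big(\sum_{j=1}^k j x_{1j},\dots,\sum_{j=1}^k j x_{mj}\Big),$$ where $(x_{ij})$ ranges over the $m\times k$ matrices of nonnegative integers with $\sum_{i=1}^m x_{ij}=c_j$ for each $j$. Let $\mathbf{X}_k=(X_1,\dots,X_k)$, where $X_1,\dots,X_k$ are independent Poisson random variables with $\mathbb{E}X_j=1/j$. Then $\mathbb{E}|\mathscr{L}_m(\mathbf{X}_k)|<\infty$, and $$i(n,\mathbf{k})\le C\Big(\frac{k_{m-1}}{k}\Big)^m\frac{\mathbb{E}|\mathscr{L}_m(\mathbf{X}_k)|}{k^{m-1}},$$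 where $C>0$ depends only on $m$. Moreover, for every real $c$ there are constants $C_1,C_2>0$ depending only on $m$ and $c$ such that, whenever $k_{m-1}\le c\,k_1$, $$C_1\,\frac{\mathbb{E}|\mathscr{L}_m(\mathbf{X}_k)|}{k^{m-1}}\le i(n,\mathbf{k})\le C_2\,\frac{\mathbb{E}|\mathscr{L}_m(\mathbf{X}_k)|}{k^{m-1}}.$$ -/

import Mathlib

open MeasureTheory ProbabilityTheory
open scoped BigOperators NNReal Nat

/-- For `c = (c_1, …, c_k)` (with `c_j` stored at index `j - 1` of `Fin k`), the set `ℒ_m(c)` of all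
`m`-tuples `(∑ j, j x_{1j}, …, ∑ j, j x_{mj})`, where `(x_{ij})` ranges over the `m × k` matrices of
nonnegative integers with `∑ i, x_{ij} = c_j` for every `j`. -/
def sumTuples (m : ℕ) {k : ℕ} (c : Fin k → ℕ) : Set (Fin m → ℕ) :=
  {s | ∃ x : Matrix (Fin m) (Fin k) ℕ,
    (∀ j, ∑ i, x i j = c j) ∧ ∀ i, s i = ∑ j : Fin k, ((j : ℕ) + 1) * x i j}

/-- `ℒ_m(c)` is finite, so `Set.ncard` is its true cardinality. -/
theorem sumTuples_finite (m : ℕ) {k : ℕ} (c : Fin k → ℕ) : (sumTuples m c).Finite := by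
  refine (Set.finite_Iic (fun _ : Fin m => ∑ j : Fin k, ((j : ℕ) + 1) * c j)).subset ?_
  rintro s ⟨x, hx, hs⟩ i
  rw [hs i]
  refine Finset.sum_le_sum fun j _ => Nat.mul_le_mul_left _ ?_
  rw [← hx j]
  exact Finset.single_le_sum (f := fun i => x i j) (fun _ _ => Nat.zero_le _) (Finset.mem_univ i)

/-- `π` has pairwise disjoint fixed (that is, invariant) sets `A_1, …, A_m` with `|A_i| = k_i`. -/
def HasFixedSets {n m : ℕ} (k : Fin m → ℕ) (π : Equiv.Perm (Fin n)) : Prop :=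
  ∃ A : Fin m → Finset (Fin n),
    (∀ i, (A i).card = k i) ∧ (∀ i j, i ≠ j → Disjoint (A i) (A j)) ∧
      ∀ i, (A i).image π = A i

/-- `i(n, k)`: the proportion of permutations of `n` points that have pairwise disjoint fixed sets
of sizes `k_1, …, k_m`. -/
noncomputable def fixedSetsProportion (n : ℕ) {m : ℕ} (k : Fin m → ℕ) : ℝ :=
  (Nat.card {π : Equiv.Perm (Fin n) // HasFixedSets k π} : ℝ) / (n ! : ℝ)

/-- `X_1, …, X_k` (with `X_j` stored at index `j - 1`) are independent Poisson random variables on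
the probability space `(Ω, P)`, and `X_j` has mean `1 / j`. -/
structure IsHarmonicPoisson {Ω : Type*} [MeasurableSpace Ω] (P : Measure Ω) {k : ℕ}
    (X : Fin k → Ω → ℕ) : Prop where
  indep : iIndepFun X P
  law : ∀ j : Fin k, HasLaw (X j) (poissonMeasure (1 / (((j : ℕ) : ℝ≥0) + 1))) P

/-! By Cauchy's formula a cycle type `s` has probability `1 / centralizerOrder s`. When the sizes `k
i` sum to `n`, whether the required invariant sets exist depends only on `s`: its cycles must split
into `m` groups with totals `k i`, i.e. `k ∈ rowSums m s`. So the proportion is a weighted sum over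
multisets. The same weights, restricted to parts at most `k₁`, are up to the factor `exp (-harmonic
k₁)` the joint law of the independent Poisson variables, so the expectation of `|ℒ_m|` is `smoothSum
m k₁ / k₁` up to bounded factors. It remains to compare the proportion with `smoothSum m k₁ / k₁ ^
m`.

Upper bound (`exists_adjoinCycles`, `tsum_partWeight_rowSums_le`). Split `s` into groups and let `l
i` be the largest cycle of group `i`, with `l i₀` the largest of all and `l i₁` the next. Remove one
cycle `l i` from each group `i ≠ i₀`, and all cycles of length at least `l i₁` from group `i₀`. The
remainder `a`, with row sums `v`, has parts at most `K = k_{m-1}`. Given `a` and `v`, each removed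
cycle has forced length `k i - v i = l i` and costs `1 / l i`; the tail from group `i₀` has forced
total and no part below `l i₁`, and costs at most `1 / l i₁`. Summing over `v` produces `|ℒ_m|`. If
some `l i` is small, the short parts of `a` must be unusually heavy: `1 / l` is dominated by `k₁⁻²
(√k₁ + S)²`, where `S` is the sum of the square roots of the parts up to `k₁` (`inv_le_sqrtSum`),
and the moments of `√k₁ + S` have the right order (`tsum_sqrtSum_pow_le`). Passing from `smoothSum m
K` to `smoothSum m k₁` costs `(K / k₁) ^ m`.

Lower bound (`smoothSum_le_tsum_partWeight_rowSums`). Reverse the construction. Take `a` with parts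
at most a small multiple of `k₁` and total at most `k₁ / 2`, which loses only a constant, then
adjoin the cycles `k i - v i` and a tail of long cycles. Every weight factor is at least of order `1
/ K`, and a given `s` arises from boundedly many data.

Two tools recur: the Stein–Chen identity, trading a factor `j * count j` for the insertion of a part
`j`, and the fact that such an insertion multiplies the number of row sums by at most `m`. -/

open scoped ENNReal

/-! ### Centralizer orders, weights of cycle types and the Stein–Chen identity -/

/-- The order of the centralizer of a permutation whose cycle lengths are the members of `s`. -/
def centralizerOrder (s : Multiset ℕ) : ℕ := s.prod * ∏ j ∈ s.toFinset, (s.count j)!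

theorem centralizerOrder_zero : centralizerOrder 0 = 1 := by simp [centralizerOrder]

theorem centralizerOrder_cons (j : ℕ) (s : Multiset ℕ) :
    centralizerOrder (j ::ₘ s) = centralizerOrder s * (j * (s.count j + 1)) := by
  have key : ∀ t : Multiset ℕ, ∏ i ∈ t.toFinset, (t.count i)! =
      ∏ i ∈ (j ::ₘ s).toFinset ∪ t.toFinset, (t.count i)! := by
    intro t
    refine Finset.prod_subset Finset.subset_union_right fun i _ hi => ?_
    rw [Multiset.mem_toFinset] at hi
    simp [Multiset.count_eq_zero_of_notMem hi]
  have h1 : (j ::ₘ s).toFinset ∪ s.toFinset = (j ::ₘ s).toFinset := by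
    ext i; simp
  have hj : j ∈ (j ::ₘ s).toFinset := by simp
  rw [centralizerOrder, centralizerOrder, key s, h1, ← Finset.mul_prod_erase _ _ hj,
    ← Finset.mul_prod_erase _ _ hj, Multiset.prod_cons, Multiset.count_cons_self,
    Nat.factorial_succ]
  have h2 : ∏ i ∈ (j ::ₘ s).toFinset.erase j, ((j ::ₘ s).count i)! =
      ∏ i ∈ (j ::ₘ s).toFinset.erase j, (s.count i)! :=
    Finset.prod_congr rfl fun i hi => by
      rw [Multiset.count_cons_of_ne (Finset.ne_of_mem_erase hi)]
  rw [h2]; ring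

theorem centralizerOrder_pos {s : Multiset ℕ} (hs : ∀ j ∈ s, 1 ≤ j) : 0 < centralizerOrder s :=
  Nat.mul_pos (Multiset.prod_pos fun j hj => hs j hj)
    (Finset.prod_pos fun _ _ => Nat.factorial_pos _)

theorem centralizerOrder_mul_le (a b : Multiset ℕ) :
    centralizerOrder a * centralizerOrder b ≤ centralizerOrder (a + b) := by
  induction a using Multiset.induction_on with
  | empty => simp [centralizerOrder_zero]
  | cons j a ih =>
    rw [Multiset.cons_add, centralizerOrder_cons, centralizerOrder_cons, Multiset.count_add,
      mul_right_comm]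
    exact Nat.mul_le_mul ih (Nat.mul_le_mul_left _ (by omega))

theorem centralizerOrder_add_of_disjoint {a b : Multiset ℕ} (h : ∀ j ∈ a, j ∉ b) :
    centralizerOrder (a + b) = centralizerOrder a * centralizerOrder b := by
  induction a using Multiset.induction_on with
  | empty => simp [centralizerOrder_zero]
  | cons j a ih =>
    rw [Multiset.cons_add, centralizerOrder_cons, centralizerOrder_cons, Multiset.count_add,
      Multiset.count_eq_zero_of_notMem (h j (by simp)),
      ih fun i hi => h i (Multiset.mem_cons_of_mem hi), add_zero]
    ring

theorem prod_le_centralizerOrder (s : Multiset ℕ) : s.prod ≤ centralizerOrder s :=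
  Nat.le_mul_of_pos_right _ (Finset.prod_pos fun _ _ => Nat.factorial_pos _)

/-- Adjoining a part `j` multiplies the order by `j` times the new multiplicity of `j`, which never
exceeds `t.card + B`. -/
theorem centralizerOrder_add_le {t b : Multiset ℕ} {B : ℕ} (h : ∀ j ∈ t, b.count j ≤ B) :
    centralizerOrder (t + b) ≤
      t.prod * centralizerOrder b * (t.card + B) ^ t.card := by
  induction t using Multiset.induction_on with
  | empty => simp
  | cons j t ih =>
    rw [Multiset.cons_add, centralizerOrder_cons, Multiset.count_add, Multiset.prod_cons,
      Multiset.card_cons, pow_succ]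
    have h1 := ih fun i hi => h i (Multiset.mem_cons_of_mem hi)
    have h2 : t.count j + b.count j + 1 ≤ t.card + 1 + B := by
      have := Multiset.count_le_card j t
      have := h j (by simp)
      omega
    calc centralizerOrder (t + b) * (j * (t.count j + b.count j + 1))
        ≤ (t.prod * centralizerOrder b * (t.card + 1 + B) ^ t.card) * (j * (t.card + 1 + B)) := by
          gcongr
          refine h1.trans ?_
          gcongr
          omega
      _ = _ := by ring

theorem centralizerOrder_replicate_add {a : ℕ} {s : Multiset ℕ} (h : a ∉ s) (n : ℕ) :
    centralizerOrder (Multiset.replicate n a + s) = a ^ n * n ! * centralizerOrder s := by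
  induction n with
  | zero => simp
  | succ n ih =>
    rw [Multiset.replicate_succ, Multiset.cons_add, centralizerOrder_cons, ih, Multiset.count_add,
      Multiset.count_eq_zero_of_notMem h, Multiset.count_replicate_self, Nat.factorial_succ]
    ring

open Classical in
/-- The weight `1 / centralizerOrder s` of the cycle type `s` if all its members lie in `P`, and
`0` otherwise. -/
noncomputable def partWeight (P : Set ℕ) (s : Multiset ℕ) : ℝ≥0∞ :=
  if ∀ j ∈ s, j ∈ P then ((centralizerOrder s : ℕ) : ℝ≥0∞)⁻¹ else 0

theorem partWeight_of_forall {P : Set ℕ} {s : Multiset ℕ} (h : ∀ j ∈ s, j ∈ P) :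
    partWeight P s = ((centralizerOrder s : ℕ) : ℝ≥0∞)⁻¹ := if_pos h

theorem partWeight_of_not {P : Set ℕ} {s : Multiset ℕ} (h : ¬ ∀ j ∈ s, j ∈ P) :
    partWeight P s = 0 := if_neg h

theorem partWeight_zero (P : Set ℕ) : partWeight P 0 = 1 := by
  simp [partWeight, centralizerOrder_zero]

theorem count_mul_partWeight_cons {P : Set ℕ} {j : ℕ} (hj : j ∈ P) (hj1 : 1 ≤ j)
    (s : Multiset ℕ) :
    ((j ::ₘ s).count j : ℝ≥0∞) * j * partWeight P (j ::ₘ s) = partWeight P s := by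
  by_cases h : ∀ i ∈ s, i ∈ P
  · have h' : ∀ i ∈ j ::ₘ s, i ∈ P := by simpa [hj] using h
    rw [partWeight_of_forall h, partWeight_of_forall h', centralizerOrder_cons,
      Multiset.count_cons_self]
    push_cast
    have hc : (s.count j : ℝ≥0∞) + 1 ≠ 0 := by simp
    have hc' : (s.count j : ℝ≥0∞) + 1 ≠ ⊤ := by finiteness
    have hj0 : (j : ℝ≥0∞) ≠ 0 := by simp; omega
    have hj' : (j : ℝ≥0∞) * (s.count j + 1) ≠ 0 := mul_ne_zero hj0 hc
    have hj'' : (j : ℝ≥0∞) * (s.count j + 1) ≠ ⊤ := by finiteness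
    rw [ENNReal.mul_inv (Or.inr hj'') (Or.inr hj'), mul_comm _ (j : ℝ≥0∞), mul_comm,
      mul_assoc, ENNReal.inv_mul_cancel hj' hj'', mul_one]
  · have h' : ¬ ∀ i ∈ j ::ₘ s, i ∈ P := by
      intro h'; exact h fun i hi => h' i (Multiset.mem_cons_of_mem hi)
    rw [partWeight_of_not h, partWeight_of_not h', mul_zero]

/-- The Stein–Chen identity for the Poisson weights. -/
theorem tsum_count_mul_partWeight {P : Set ℕ} {j : ℕ} (hj : j ∈ P) (hj1 : 1 ≤ j)
    (F : Multiset ℕ → ℝ≥0∞) :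
    ∑' s, (s.count j : ℝ≥0∞) * j * partWeight P s * F s = ∑' s, partWeight P s * F (j ::ₘ s) := by
  have hinj : Function.Injective (fun s : Multiset ℕ => j ::ₘ s) :=
    fun _ _ h => (Multiset.cons_inj_right j).mp h
  rw [← hinj.tsum_eq]
  · exact tsum_congr fun s => by rw [count_mul_partWeight_cons hj hj1]
  · intro s hs
    have : j ∈ s := by
      by_contra h
      simp [Multiset.count_eq_zero_of_notMem h] at hs
    exact ⟨s.erase j, Multiset.cons_erase this⟩

/-- Independence of the multiplicities: the multiplicity `n` of `a` has the unnormalised Poisson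
weight `1 / (a ^ n * n !)`, whatever the other parts are. -/
theorem tsum_partWeight_insert {P : Set ℕ} {a : ℕ} (ha : a ∉ P) (F : Multiset ℕ → ℝ≥0∞) :
    ∑' s, partWeight (insert a P) s * F s =
      ∑' n : ℕ, ((a ^ n * n ! : ℕ) : ℝ≥0∞)⁻¹ *
        ∑' s, partWeight P s * F (Multiset.replicate n a + s) := by
  classical
  have h1 : ∀ s : Multiset ℕ, partWeight (insert a P) s * F s =
      ∑' n : ℕ, if s.count a = n then partWeight (insert a P) s * F s else 0 := by
    intro s; rw [tsum_eq_single (s.count a) fun n hn => if_neg hn.symm, if_pos rfl]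
  rw [tsum_congr h1, ENNReal.tsum_comm]
  refine tsum_congr fun n => ?_
  rw [← ENNReal.tsum_mul_left]
  have hinj : Function.Injective (fun s : Multiset ℕ => Multiset.replicate n a + s) :=
    add_right_injective _
  rw [← hinj.tsum_eq]
  · refine tsum_congr fun s => ?_
    by_cases hs : a ∈ s
    · have h2 : ¬ (Multiset.replicate n a + s).count a = n := by
        have := Multiset.count_pos.mpr hs
        rw [Multiset.count_add, Multiset.count_replicate_self]; omega
      rw [if_neg h2, partWeight_of_not fun h => ha (h a hs), zero_mul, mul_zero]
    · have h2 : (Multiset.replicate n a + s).count a = n := by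
        rw [Multiset.count_add, Multiset.count_replicate_self,
          Multiset.count_eq_zero_of_notMem hs, add_zero]
      rw [if_pos h2, ← mul_assoc]
      congr 1
      by_cases hP : ∀ j ∈ s, j ∈ P
      · rw [partWeight_of_forall hP, partWeight_of_forall, centralizerOrder_replicate_add hs]
        · push_cast
          rw [ENNReal.mul_inv]
          · right; exact ENNReal.natCast_ne_top _
          · left; finiteness
        · intro j hj
          rcases Multiset.mem_add.mp hj with hj | hj
          · left; exact Multiset.eq_of_mem_replicate hj
          · right; exact hP j hj
      · rw [partWeight_of_not hP, partWeight_of_not, mul_zero]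
        intro h
        refine hP fun j hj => ?_
        rcases h j (Multiset.mem_add.mpr (Or.inr hj)) with rfl | h
        · exact absurd hj hs
        · exact h
  · intro s hs
    have : s.count a = n := by
      by_contra h
      simp [h] at hs
    exact ⟨s - Multiset.replicate n a, add_tsub_cancel_of_le
      (Multiset.le_count_iff_replicate_le.mp this.ge)⟩

/-! ### Cycle types without short cycles -/

/-- The proportion of permutations of `N` points all of whose cycles are longer than `M`. -/
noncomputable def roughProportion (M N : ℕ) : ℝ≥0∞ :=
  ∑' s : Multiset ℕ, partWeight (Set.Ioi M) s * if s.sum = N then 1 else 0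

theorem sum_eq_sum_count_mul (s : Multiset ℕ) {A : Finset ℕ} (h : ∀ j ∈ s, j ∈ A) :
    s.sum = ∑ j ∈ A, s.count j * j := by
  rw [Finset.sum_multiset_count]
  simp only [smul_eq_mul]
  refine Finset.sum_subset (fun j hj => h j (Multiset.mem_toFinset.mp hj)) fun j _ hj => ?_
  rw [Multiset.mem_toFinset] at hj
  simp [Multiset.count_eq_zero_of_notMem hj]

theorem roughProportion_zero (M : ℕ) : roughProportion M 0 = 1 := by
  rw [roughProportion, tsum_eq_single 0]
  · simp [partWeight_zero]
  · intro s hs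
    by_cases h : ∀ j ∈ s, j ∈ Set.Ioi M
    · have : s.sum ≠ 0 := by
        intro h0
        obtain ⟨j, hj⟩ := Multiset.exists_mem_of_ne_zero hs
        have h1 := Multiset.sum_eq_zero_iff.mp h0 j hj
        have h2 := h j hj
        simp [h1] at h2
      simp [this]
    · simp [partWeight_of_not h]

/-- Write `N` as the sum of `j * count j` over the parts and apply the Stein–Chen identity to each
term: removing a part `j > M` leaves a rough cycle type of total `N - j < N - M`. -/
theorem mul_roughProportion (M N : ℕ) :
    (N : ℝ≥0∞) * roughProportion M N = ∑ t ∈ Finset.range (N - M), roughProportion M t := by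
  have h1 : (N : ℝ≥0∞) * roughProportion M N =
      ∑ j ∈ Finset.Ioc M N, ∑' s : Multiset ℕ,
        (s.count j : ℝ≥0∞) * j * partWeight (Set.Ioi M) s * if s.sum = N then 1 else 0 := by
    rw [roughProportion, ← ENNReal.tsum_mul_left, ← Summable.tsum_finsetSum
      fun _ _ => ENNReal.summable]
    refine tsum_congr fun s => ?_
    by_cases hs : s.sum = N
    · by_cases h : ∀ j ∈ s, j ∈ Set.Ioi M
      · have : s.sum = ∑ j ∈ Finset.Ioc M N, s.count j * j :=
          sum_eq_sum_count_mul s fun j hj => Finset.mem_Ioc.mpr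
            ⟨h j hj, hs ▸ Multiset.le_sum_of_mem hj⟩
        simp only [hs, if_true, mul_one]
        rw [← Finset.sum_mul]
        congr 1
        have h2 : N = ∑ j ∈ Finset.Ioc M N, s.count j * j := hs ▸ this
        exact_mod_cast congrArg (Nat.cast : ℕ → ℝ≥0∞) h2
      · simp [partWeight_of_not h]
    · simp [hs]
  have h2 : ∀ j ∈ Finset.Ioc M N, ∑' s : Multiset ℕ,
      (s.count j : ℝ≥0∞) * j * partWeight (Set.Ioi M) s * (if s.sum = N then 1 else 0) =
      roughProportion M (N - j) := by
    intro j hj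
    rw [Finset.mem_Ioc] at hj
    rw [tsum_count_mul_partWeight (P := Set.Ioi M) (j := j) hj.1 (by omega)
      (fun s => if s.sum = N then 1 else 0), roughProportion]
    refine tsum_congr fun s => ?_
    rw [Multiset.sum_cons]
    congr 1
    refine if_congr ?_ rfl rfl
    omega
  rw [h1, Finset.sum_congr rfl h2]
  refine Finset.sum_bij' (fun j _ => N - j) (fun t _ => N - t) ?_ ?_ ?_ ?_ ?_ <;>
    simp only [Finset.mem_Ioc, Finset.mem_range] <;> intros <;> first | omega | trivial

theorem roughProportion_eq_zero {M N : ℕ} (h1 : 1 ≤ N) (h2 : N ≤ M) :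
    roughProportion M N = 0 := by
  have := mul_roughProportion M N
  rw [Nat.sub_eq_zero_of_le h2, Finset.range_zero, Finset.sum_empty, mul_eq_zero] at this
  rcases this with h | h
  · simp at h; omega
  · exact h

theorem sum_range_eq_zero_add_Ioo {f : ℕ → ℝ≥0∞} {M a : ℕ} (ha : 1 ≤ a)
    (hf : ∀ t, 1 ≤ t → t ≤ M → f t = 0) :
    ∑ t ∈ Finset.range a, f t = f 0 + ∑ t ∈ Finset.Ioo M a, f t := by
  rw [← Finset.sum_insert (by simp)]
  symm
  refine Finset.sum_subset ?_ ?_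
  · intro t; simp; omega
  · intro t ht h
    simp at ht h
    exact hf t (by omega) (by omega)

/-- Induction through the recursion. Only `t = 0` and `M < t < N - M` contribute, so `N` times the
proportion is at most `1 + (N - 2 * M - 1) / (M + 1) ≤ N / (M + 1)`, with truncated subtraction. -/
theorem roughProportion_le {M : ℕ} (N : ℕ) (hN : 1 ≤ N) :
    roughProportion M N ≤ ((M : ℝ≥0∞) + 1)⁻¹ := by
  induction N using Nat.strong_induction_on with
  | _ N ih =>
    rcases Nat.lt_or_ge M N with h | h
    swap
    · rw [roughProportion_eq_zero hN h]; simp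
    have h0 : (N : ℝ≥0∞) ≠ 0 := by simp; omega
    have hM0 : (M : ℝ≥0∞) + 1 ≠ 0 := by simp
    have hMt : (M : ℝ≥0∞) + 1 ≠ ⊤ := by finiteness
    rw [← ENNReal.mul_le_mul_iff_right h0 (ENNReal.natCast_ne_top N), mul_roughProportion,
      sum_range_eq_zero_add_Ioo (by omega) fun t => roughProportion_eq_zero, roughProportion_zero]
    calc 1 + ∑ t ∈ Finset.Ioo M (N - M), roughProportion M t
        ≤ 1 + ∑ t ∈ Finset.Ioo M (N - M), ((M : ℝ≥0∞) + 1)⁻¹ := by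
          gcongr with t ht
          rw [Finset.mem_Ioo] at ht
          exact ih t (by omega) (by omega)
      _ = (((M : ℝ≥0∞) + 1) + ((N - M - M - 1 : ℕ) : ℝ≥0∞)) * ((M : ℝ≥0∞) + 1)⁻¹ := by
          rw [Finset.sum_const, Nat.card_Ioo, nsmul_eq_mul, add_mul, ENNReal.mul_inv_cancel hM0 hMt]
      _ ≤ _ := by
          gcongr
          have : M + 1 + (N - M - M - 1) ≤ N := by omega
          exact_mod_cast this

/-- The same induction from below; `2 * M + 1` is chosen so that `N ≤ (2 * M + 1) + (N - M - M - 1)`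
also under truncated subtraction. -/
theorem le_roughProportion {M : ℕ} (N : ℕ) (hN : M < N) :
    (2 * (M : ℝ≥0∞) + 1)⁻¹ ≤ roughProportion M N := by
  induction N using Nat.strong_induction_on with
  | _ N ih =>
    have h0 : (N : ℝ≥0∞) ≠ 0 := by simp; omega
    have hM0 : 2 * (M : ℝ≥0∞) + 1 ≠ 0 := by simp
    have hMt : 2 * (M : ℝ≥0∞) + 1 ≠ ⊤ := by finiteness
    rw [← ENNReal.mul_le_mul_iff_right h0 (ENNReal.natCast_ne_top N), mul_roughProportion,
      sum_range_eq_zero_add_Ioo (by omega) fun t => roughProportion_eq_zero, roughProportion_zero]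
    calc (N : ℝ≥0∞) * (2 * (M : ℝ≥0∞) + 1)⁻¹
        ≤ ((2 * (M : ℝ≥0∞) + 1) + ((N - M - M - 1 : ℕ) : ℝ≥0∞)) * (2 * (M : ℝ≥0∞) + 1)⁻¹ := by
          gcongr
          have : N ≤ 2 * M + 1 + (N - M - M - 1) := by omega
          exact_mod_cast this
      _ = 1 + ∑ t ∈ Finset.Ioo M (N - M), (2 * (M : ℝ≥0∞) + 1)⁻¹ := by
          rw [Finset.sum_const, Nat.card_Ioo, nsmul_eq_mul, add_mul, ENNReal.mul_inv_cancel hM0 hMt]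
      _ ≤ _ := by
          gcongr with t ht
          rw [Finset.mem_Ioo] at ht
          exact ih t (by omega) (by omega)

/-! ### Row sums and the smooth sum -/

/-- The set of vectors `(∑ r_1, …, ∑ r_m)`, where `r_1, …, r_m` are multisets whose union is `s`. -/
def rowSums (m : ℕ) (s : Multiset ℕ) : Set (Fin m → ℕ) :=
  {v | ∃ r : Fin m → Multiset ℕ, ∑ i, r i = s ∧ ∀ i, v i = (r i).sum}

theorem rowSums_zero (m : ℕ) : rowSums m 0 = {0} := by
  ext v
  simp only [rowSums, Set.mem_ofPred_eq, Set.mem_singleton_iff]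
  constructor
  · rintro ⟨r, hr, hv⟩
    ext i
    have : r i = 0 := by
      have := Finset.sum_eq_zero_iff.mp hr i (Finset.mem_univ i)
      exact this
    simp [hv, this]
  · rintro rfl
    exact ⟨0, by simp, by simp⟩

theorem rowSums_cons_subset (m : ℕ) (j : ℕ) (s : Multiset ℕ) :
    rowSums m (j ::ₘ s) ⊆ ⋃ i : Fin m, (fun v => v + Pi.single i j) '' rowSums m s := by
  rintro v ⟨r, hr, hv⟩
  have hj : j ∈ ∑ i, r i := hr ▸ Multiset.mem_cons_self j s
  obtain ⟨i, -, hi⟩ := Multiset.mem_sum.mp hj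
  have hcons : ∀ i', r i' = Function.update r i ((r i).erase j) i' +
      (Pi.single i {j} : Fin m → Multiset ℕ) i' := by
    intro i'
    rcases eq_or_ne i' i with rfl | h
    · rw [Function.update_self, Pi.single_eq_same, add_comm, Multiset.singleton_add,
        Multiset.cons_erase hi]
    · rw [Function.update_of_ne h, Pi.single_eq_of_ne h, add_zero]
  refine Set.mem_iUnion.mpr ⟨i, fun i' => (Function.update r i ((r i).erase j) i').sum,
    ⟨_, ?_, fun _ => rfl⟩, ?_⟩
  · have h1 : ∑ i', r i' = ∑ i', Function.update r i ((r i).erase j) i' + {j} := by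
      rw [Finset.sum_congr rfl fun i' _ => hcons i', Finset.sum_add_distrib,
        Finset.sum_pi_single']
      simp
    rw [hr, add_comm, Multiset.singleton_add] at h1
    exact ((Multiset.cons_inj_right j).mp h1).symm
  · ext i'
    rcases eq_or_ne i' i with rfl | h
    · simp [hv, ← Multiset.sum_cons, Multiset.cons_erase hi, add_comm _ j]
    · simp [hv, h]

theorem rowSums_finite (m : ℕ) (s : Multiset ℕ) : (rowSums m s).Finite := by
  induction s using Multiset.induction_on with
  | empty => simp [rowSums_zero]
  | cons j s ih =>
    exact (Set.finite_iUnion fun i => ih.image _).subset (rowSums_cons_subset m j s)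

/-- The number of vectors in `rowSums m s`, as an extended nonnegative real. -/
noncomputable def numRowSums (m : ℕ) (s : Multiset ℕ) : ℝ≥0∞ := ((rowSums m s).ncard : ℕ)

theorem numRowSums_zero (m : ℕ) : numRowSums m 0 = 1 := by simp [numRowSums, rowSums_zero]

/-- The new part lies in one of `m` groups, and deleting it there leaves a row-sum vector of `s`.
This is the growth bound behind every moment estimate below. -/
theorem numRowSums_cons_le (m : ℕ) (j : ℕ) (s : Multiset ℕ) :
    numRowSums m (j ::ₘ s) ≤ m * numRowSums m s := by
  have h1 : (rowSums m (j ::ₘ s)).ncard ≤ m * (rowSums m s).ncard := by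
    refine (Set.ncard_le_ncard (rowSums_cons_subset m j s)
      (Set.finite_iUnion fun i => (rowSums_finite m s).image _)).trans ?_
    refine (Set.ncard_iUnion_le_of_fintype _).trans ?_
    refine (Finset.sum_le_card_nsmul _ _ _
      fun i _ => Set.ncard_image_le (rowSums_finite m s)).trans ?_
    simp
  rw [numRowSums, numRowSums]
  exact_mod_cast h1

theorem numRowSums_replicate_add_le (m a n : ℕ) (s : Multiset ℕ) :
    numRowSums m (Multiset.replicate n a + s) ≤ (m : ℝ≥0∞) ^ n * numRowSums m s := by
  induction n with
  | zero => simp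
  | succ n ih =>
    rw [Multiset.replicate_succ, Multiset.cons_add, pow_succ', mul_assoc]
    exact (numRowSums_cons_le m a _).trans (by gcongr)

/-- The weighted sum of `numRowSums m` over all cycle types without cycles longer than `K`. -/
noncomputable def smoothSum (m K : ℕ) : ℝ≥0∞ :=
  ∑' s, partWeight (Set.Icc 1 K) s * numRowSums m s

theorem smoothSum_zero (m : ℕ) : smoothSum m 0 = 1 := by
  rw [smoothSum, tsum_eq_single 0]
  · simp [partWeight_zero, numRowSums_zero]
  · intro s hs
    obtain ⟨j, hj⟩ := Multiset.exists_mem_of_ne_zero hs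
    rw [partWeight_of_not, zero_mul]
    intro h
    have := h j hj
    simp at this

theorem tsum_pow_mul_inv_factorial (m a : ℕ) (ha : 1 ≤ a) :
    ∑' n : ℕ, ((a ^ n * n ! : ℕ) : ℝ≥0∞)⁻¹ * (m : ℝ≥0∞) ^ n =
      ENNReal.ofReal (Real.exp (m / a)) := by
  have hs : HasSum (fun n : ℕ => ((m : ℝ) / a) ^ n / n !) (Real.exp (m / a)) := by
    rw [Real.exp_eq_exp_ℝ]
    exact NormedSpace.expSeries_div_hasSum_exp _
  rw [← hs.tsum_eq, ENNReal.ofReal_tsum_of_nonneg (fun n => by positivity) hs.summable]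
  refine tsum_congr fun n => ?_
  have ha' : (0 : ℝ) < (a : ℝ) := by exact_mod_cast ha
  have hc : 0 < a ^ n * n ! := Nat.mul_pos (pow_pos ha n) (Nat.factorial_pos n)
  rw [← ENNReal.ofReal_natCast (a ^ n * n !), ← ENNReal.ofReal_natCast m,
    ← ENNReal.ofReal_inv_of_pos (by exact_mod_cast hc), ← ENNReal.ofReal_pow (by positivity),
    ← ENNReal.ofReal_mul (by positivity)]
  congr 1
  push_cast
  rw [div_pow]
  field_simp

theorem Icc_one_succ_eq_insert (K : ℕ) :
    Set.Icc 1 (K + 1) = insert (K + 1) (Set.Icc 1 K) := by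
  ext j; simp only [Set.mem_Icc, Set.mem_insert_iff]; omega

theorem smoothSum_succ_le (m K : ℕ) :
    smoothSum m (K + 1) ≤ ENNReal.ofReal (Real.exp (m / (K + 1 : ℕ))) * smoothSum m K := by
  rw [smoothSum, Icc_one_succ_eq_insert, tsum_partWeight_insert (by simp),
    ← tsum_pow_mul_inv_factorial m (K + 1) (by omega), ← ENNReal.tsum_mul_right]
  refine ENNReal.tsum_le_tsum fun n => ?_
  rw [mul_assoc, smoothSum, ← ENNReal.tsum_mul_left (a := (m : ℝ≥0∞) ^ n)]
  refine mul_le_mul_right (ENNReal.tsum_le_tsum fun s => ?_) _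
  rw [mul_left_comm]
  exact mul_le_mul_right (numRowSums_replicate_add_le m (K + 1) n s) _

theorem smoothSum_ne_top (m K : ℕ) : smoothSum m K ≠ ⊤ := by
  induction K with
  | zero => simp [smoothSum_zero]
  | succ K ih =>
    exact ne_top_of_le_ne_top (ENNReal.mul_ne_top ENNReal.ofReal_ne_top ih) (smoothSum_succ_le m K)

/-- This form makes the product over successive `K` telescope to `(K / k) ^ m`. -/
theorem exp_div_succ_le (m : ℕ) {K : ℕ} (hK : 1 ≤ K) :
    Real.exp (m / (K + 1 : ℕ)) ≤ (((K + 1 : ℕ) : ℝ) / K) ^ m := by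
  have hK' : (0 : ℝ) < K := by exact_mod_cast hK
  have h1 : Real.exp (1 / (K + 1 : ℕ)) ≤ ((K + 1 : ℕ) : ℝ) / K := by
    have := Real.one_sub_le_exp_neg (1 / ((K + 1 : ℕ) : ℝ))
    rw [Real.exp_neg] at this
    have h2 : 1 - 1 / ((K + 1 : ℕ) : ℝ) = (((K + 1 : ℕ) : ℝ) / K)⁻¹ := by
      push_cast; field_simp; ring
    rw [h2] at this
    exact (inv_le_inv₀ (by positivity) (by positivity)).mp this
  have h3 : Real.exp (m / (K + 1 : ℕ)) = Real.exp (1 / (K + 1 : ℕ)) ^ m := by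
    rw [← Real.exp_nat_mul]; congr 1; ring
  rw [h3]
  gcongr

theorem smoothSum_le_of_le (m : ℕ) {k K : ℕ} (hk : 1 ≤ k) (hkK : k ≤ K) :
    smoothSum m K ≤ ENNReal.ofReal (((K : ℝ) / k) ^ m) * smoothSum m k := by
  have hk' : (0 : ℝ) < k := by exact_mod_cast hk
  induction K, hkK using Nat.le_induction with
  | base => simp [div_self hk'.ne']
  | succ K hK ih =>
    have hK' : (0 : ℝ) < K := by exact_mod_cast (by omega : 0 < K)
    calc smoothSum m (K + 1)
        ≤ ENNReal.ofReal (Real.exp (m / (K + 1 : ℕ))) * smoothSum m K := smoothSum_succ_le m K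
      _ ≤ ENNReal.ofReal ((((K + 1 : ℕ) : ℝ) / K) ^ m) *
          (ENNReal.ofReal (((K : ℝ) / k) ^ m) * smoothSum m k) := by
          gcongr
          exact exp_div_succ_le m (by omega)
      _ = _ := by
          rw [← mul_assoc, ← ENNReal.ofReal_mul (by positivity), ← mul_pow]
          congr 3
          field_simp

/-! ### From multisets to Poisson vectors -/

theorem centralizerOrder_eq_prod {s : Multiset ℕ} {A : Finset ℕ} (h : ∀ j ∈ s, j ∈ A) :
    centralizerOrder s = ∏ j ∈ A, j ^ s.count j * (s.count j)! := by
  rw [centralizerOrder, Finset.prod_multiset_count, ← Finset.prod_mul_distrib]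
  refine Finset.prod_subset (fun j hj => h j (Multiset.mem_toFinset.mp hj)) fun j _ hj => ?_
  rw [Multiset.mem_toFinset] at hj
  simp [Multiset.count_eq_zero_of_notMem hj]

/-- The multiset in which `j + 1` has multiplicity `c j`. -/
def ofCounts {k : ℕ} (c : Fin k → ℕ) : Multiset ℕ :=
  ∑ j : Fin k, Multiset.replicate (c j) ((j : ℕ) + 1)

theorem mem_Icc_of_mem_ofCounts {k : ℕ} {c : Fin k → ℕ} {i : ℕ} (h : i ∈ ofCounts c) :
    i ∈ Set.Icc 1 k := by
  obtain ⟨j, -, hj⟩ := Multiset.mem_sum.mp h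
  have := Multiset.eq_of_mem_replicate hj
  exact ⟨by omega, by omega⟩

theorem count_ofCounts {k : ℕ} (c : Fin k → ℕ) (j : Fin k) :
    (ofCounts c).count ((j : ℕ) + 1) = c j := by
  rw [ofCounts, Multiset.count_sum', Finset.sum_eq_single j]
  · simp
  · intro i _ hi
    rw [Multiset.count_replicate, if_neg]
    intro h
    exact hi (Fin.ext (by omega))
  · simp

theorem ofCounts_count {k : ℕ} {s : Multiset ℕ} (h : ∀ i ∈ s, i ∈ Set.Icc 1 k) :
    ofCounts (fun j : Fin k => s.count ((j : ℕ) + 1)) = s := by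
  ext i
  by_cases hi : i ∈ Set.Icc 1 k
  · obtain ⟨h1, h2⟩ := hi
    have := count_ofCounts (fun j : Fin k => s.count ((j : ℕ) + 1)) ⟨i - 1, by omega⟩
    simpa [Nat.sub_add_cancel h1] using this
  · rw [Multiset.count_eq_zero_of_notMem fun hs => hi (h i hs),
      Multiset.count_eq_zero_of_notMem fun hs => hi (mem_Icc_of_mem_ofCounts hs)]

theorem sum_ofCounts {k : ℕ} (c : Fin k → ℕ) :
    (ofCounts c).sum = ∑ j : Fin k, ((j : ℕ) + 1) * c j := by
  rw [ofCounts, Multiset.sum_sum]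
  simp [mul_comm]

theorem ofCounts_sum {k : ℕ} {ι : Type*} (A : Finset ι) (x : ι → Fin k → ℕ) :
    ofCounts (fun j => ∑ i ∈ A, x i j) = ∑ i ∈ A, ofCounts (x i) := by
  simp only [ofCounts]
  rw [Finset.sum_comm]
  refine Finset.sum_congr rfl fun j _ => ?_
  ext a
  rw [Multiset.count_sum']
  simp only [Multiset.count_replicate]
  split_ifs <;> simp

theorem rowSums_ofCounts (m : ℕ) {k : ℕ} (c : Fin k → ℕ) :
    rowSums m (ofCounts c) = sumTuples m c := by
  ext v
  constructor
  · rintro ⟨r, hr, hv⟩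
    have hmem : ∀ i, ∀ a ∈ r i, a ∈ Set.Icc 1 k := fun i a ha =>
      mem_Icc_of_mem_ofCounts (c := c) (hr ▸ Multiset.mem_sum.mpr ⟨i, Finset.mem_univ i, ha⟩)
    refine ⟨fun i j => (r i).count ((j : ℕ) + 1), fun j => ?_, fun i => ?_⟩
    · rw [← count_ofCounts c j, ← hr, Multiset.count_sum']
    · rw [hv i]
      conv_lhs => rw [← ofCounts_count (hmem i)]
      rw [sum_ofCounts]
  · rintro ⟨x, hx, hv⟩
    refine ⟨fun i => ofCounts fun j => x i j, ?_, fun i => ?_⟩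
    · refine (ofCounts_sum Finset.univ fun i j => x i j).symm.trans ?_
      exact congrArg ofCounts (funext hx)
    · rw [hv i, sum_ofCounts]

theorem centralizerOrder_ofCounts {k : ℕ} (c : Fin k → ℕ) :
    centralizerOrder (ofCounts c) = ∏ j : Fin k, ((j : ℕ) + 1) ^ c j * (c j)! := by
  have hinj : Function.Injective fun j : Fin k => (j : ℕ) + 1 :=
    fun a b h => Fin.ext (Nat.succ_injective h)
  rw [centralizerOrder_eq_prod (A := Finset.univ.image fun j : Fin k => (j : ℕ) + 1),
    Finset.prod_image fun a _ b _ h => hinj h]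
  · exact Finset.prod_congr rfl fun j _ => by rw [count_ofCounts]
  · intro i hi
    obtain ⟨h1, h2⟩ := mem_Icc_of_mem_ofCounts hi
    exact Finset.mem_image.mpr ⟨⟨i - 1, by omega⟩, Finset.mem_univ _, Nat.sub_add_cancel h1⟩

theorem tsum_ofCounts (k : ℕ) (F : Multiset ℕ → ℝ≥0∞) :
    ∑' c : Fin k → ℕ, ((centralizerOrder (ofCounts c) : ℕ) : ℝ≥0∞)⁻¹ * F (ofCounts c) =
      ∑' s, partWeight (Set.Icc 1 k) s * F s := by
  have hinj : Function.Injective (ofCounts : (Fin k → ℕ) → Multiset ℕ) := by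
    intro c d h
    funext j
    rw [← count_ofCounts c j, h, count_ofCounts]
  rw [← hinj.tsum_eq]
  · refine tsum_congr fun c => ?_
    rw [partWeight_of_forall fun j hj => mem_Icc_of_mem_ofCounts hj]
  · intro s hs
    by_cases h : ∀ j ∈ s, j ∈ Set.Icc 1 k
    · exact ⟨_, ofCounts_count h⟩
    · simp [partWeight_of_not h] at hs

/-- The Poisson mass at `c` for mean `1 / j` is `exp (-1 / j) / (j ^ c * c !)`; by independence
these multiply to the reciprocal centralizer order times a constant. -/
theorem lintegral_isHarmonicPoisson {Ω : Type*} [MeasurableSpace Ω] {P : Measure Ω}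
    [IsProbabilityMeasure P] {k : ℕ} {X : Fin k → Ω → ℕ} (hX : IsHarmonicPoisson P X)
    (f : (Fin k → ℕ) → ℝ≥0∞) :
    ∫⁻ ω, f (fun j => X j ω) ∂P = ENNReal.ofReal (Real.exp (-(∑ j : Fin k, 1 / ((j : ℝ) + 1)))) *
      ∑' c : Fin k → ℕ, ((centralizerOrder (ofCounts c) : ℕ) : ℝ≥0∞)⁻¹ * f c := by
  have hm : ∀ j, AEMeasurable (X j) P := fun j => (hX.law j).aemeasurable
  have hmap : P.map (fun ω j => X j ω) =
      Measure.pi fun j : Fin k => poissonMeasure (1 / (((j : ℕ) : ℝ≥0) + 1)) := by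
    rw [(iIndepFun_iff_map_fun_eq_pi_map hm).mp hX.indep]
    congr 1
    funext j
    exact (hX.law j).map_eq
  have h1 : ∫⁻ ω, f (fun j => X j ω) ∂P = ∫⁻ c, f c ∂(P.map (fun ω j => X j ω)) :=
    (lintegral_map' (Measurable.of_discrete).aemeasurable (aemeasurable_pi_lambda _ hm)).symm
  rw [h1, hmap, lintegral_countable', ← ENNReal.tsum_mul_left]
  refine tsum_congr fun c => ?_
  rw [Measure.pi_singleton, mul_comm, ← mul_assoc]
  congr 1
  have hc : (0 : ℝ) < (centralizerOrder (ofCounts c) : ℕ) := by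
    exact_mod_cast centralizerOrder_pos fun j hj => (mem_Icc_of_mem_ofCounts hj).1
  rw [← ENNReal.ofReal_natCast, ← ENNReal.ofReal_inv_of_pos hc,
    ← ENNReal.ofReal_mul (by positivity), ← Finset.sum_neg_distrib, Real.exp_sum,
    centralizerOrder_ofCounts]
  push_cast
  rw [← Finset.prod_inv_distrib, ← Finset.prod_mul_distrib, ENNReal.ofReal_prod_of_nonneg
    fun j _ => by positivity]
  refine Finset.prod_congr rfl fun j _ => ?_
  rw [poissonMeasure_singleton]
  congr 1
  push_cast
  rw [div_pow, one_pow]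
  field_simp

theorem sum_one_div_eq_harmonic (k : ℕ) :
    ∑ j : Fin k, 1 / ((j : ℝ) + 1) = (harmonic k : ℝ) := by
  rw [harmonic, Fin.sum_univ_eq_sum_range (fun j : ℕ => 1 / ((j : ℝ) + 1))]
  push_cast
  simp

theorem lintegral_ncard_sumTuples {Ω : Type*} [MeasurableSpace Ω] {P : Measure Ω}
    [IsProbabilityMeasure P] {k : ℕ} {X : Fin k → Ω → ℕ} (hX : IsHarmonicPoisson P X) (m : ℕ) :
    ∫⁻ ω, ENNReal.ofReal ((sumTuples m fun j => X j ω).ncard : ℝ) ∂P =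
      ENNReal.ofReal (Real.exp (-(harmonic k : ℝ))) * smoothSum m k := by
  have := lintegral_isHarmonicPoisson hX
    fun c => ENNReal.ofReal ((sumTuples m c).ncard : ℝ)
  rw [this, sum_one_div_eq_harmonic, smoothSum, ← tsum_ofCounts]
  congr 1
  refine tsum_congr fun c => ?_
  rw [numRowSums, rowSums_ofCounts, ENNReal.ofReal_natCast]

theorem integrable_ncard_sumTuples {Ω : Type*} [MeasurableSpace Ω] {P : Measure Ω}
    [IsProbabilityMeasure P] {k : ℕ} {X : Fin k → Ω → ℕ} (hX : IsHarmonicPoisson P X) (m : ℕ) :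
    Integrable (fun ω => ((sumTuples m fun j => X j ω).ncard : ℝ)) P := by
  have hm : AEMeasurable (fun ω j => X j ω) P :=
    aemeasurable_pi_lambda _ fun j => (hX.law j).aemeasurable
  have hf : Measurable fun c : Fin k → ℕ => ((sumTuples m c).ncard : ℝ) := Measurable.of_discrete
  refine ⟨(hf.comp_aemeasurable hm).aestronglyMeasurable, ?_⟩
  rw [hasFiniteIntegral_iff_ofReal (Filter.Eventually.of_forall fun ω => Nat.cast_nonneg _),
    lintegral_ncard_sumTuples hX]
  exact ENNReal.mul_lt_top ENNReal.ofReal_lt_top (smoothSum_ne_top m k).lt_top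

theorem integral_ncard_sumTuples {Ω : Type*} [MeasurableSpace Ω] {P : Measure Ω}
    [IsProbabilityMeasure P] {k : ℕ} {X : Fin k → Ω → ℕ} (hX : IsHarmonicPoisson P X) (m : ℕ) :
    ∫ ω, ((sumTuples m fun j => X j ω).ncard : ℝ) ∂P =
      Real.exp (-(harmonic k : ℝ)) * (smoothSum m k).toReal := by
  rw [integral_eq_lintegral_of_nonneg_ae (Filter.Eventually.of_forall fun ω => Nat.cast_nonneg _)
    (integrable_ncard_sumTuples hX m).aestronglyMeasurable, lintegral_ncard_sumTuples hX,
    ENNReal.toReal_mul, ENNReal.toReal_ofReal (Real.exp_pos _).le]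

/-- The expectation of `|ℒ_m|` differs from `smoothSum m k / k` by a bounded factor. -/
theorem smoothSum_toReal_bounds {Ω : Type*} [MeasurableSpace Ω] {P : Measure Ω}
    [IsProbabilityMeasure P] {k : ℕ} (hk : 1 ≤ k) {X : Fin k → Ω → ℕ}
    (hX : IsHarmonicPoisson P X) (m : ℕ) :
    k * ∫ ω, ((sumTuples m fun j => X j ω).ncard : ℝ) ∂P ≤ (smoothSum m k).toReal ∧
    (smoothSum m k).toReal ≤
      Real.exp 1 * k * ∫ ω, ((sumTuples m fun j => X j ω).ncard : ℝ) ∂P := by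
  have hk' : (0 : ℝ) < k := by exact_mod_cast hk
  have hlow : (k : ℝ) ≤ Real.exp (harmonic k : ℝ) := by
    have h1 := log_add_one_le_harmonic k
    calc (k : ℝ) ≤ ((k + 1 : ℕ) : ℝ) := by push_cast; linarith
      _ = Real.exp (Real.log ((k + 1 : ℕ) : ℝ)) := (Real.exp_log (by positivity)).symm
      _ ≤ _ := Real.exp_le_exp.mpr h1
  have hup : Real.exp (harmonic k : ℝ) ≤ Real.exp 1 * k := by
    have h1 := harmonic_le_one_add_log k
    calc Real.exp (harmonic k : ℝ) ≤ Real.exp (1 + Real.log k) := Real.exp_le_exp.mpr h1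
      _ = _ := by rw [Real.exp_add, Real.exp_log hk']
  have hG : 0 ≤ (smoothSum m k).toReal := ENNReal.toReal_nonneg
  have hE : (smoothSum m k).toReal = Real.exp (harmonic k : ℝ) *
      ∫ ω, ((sumTuples m fun j => X j ω).ncard : ℝ) ∂P := by
    rw [integral_ncard_sumTuples hX, ← mul_assoc, ← Real.exp_add, add_neg_cancel, Real.exp_zero,
      one_mul]
  have hE0 : 0 ≤ ∫ ω, ((sumTuples m fun j => X j ω).ncard : ℝ) ∂P :=
    integral_nonneg fun ω => Nat.cast_nonneg _
  rw [hE]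
  exact ⟨by gcongr, by gcongr⟩

/-! ### Invariant sets and cycle types of permutations -/

theorem zpow_apply_of_semiconj {α β : Type*} {π : Equiv.Perm α} {σ : Equiv.Perm β} {g : β → α}
    (h : ∀ x, π (g x) = g (σ x)) (x : β) (n : ℤ) : (π ^ n) (g x) = g ((σ ^ n) x) := by
  have hnat : ∀ (n : ℕ) (x : β), (π ^ n) (g x) = g ((σ ^ n) x) := by
    intro n
    induction n with
    | zero => simp
    | succ n ih => intro x; rw [pow_succ, pow_succ, Equiv.Perm.mul_apply, Equiv.Perm.mul_apply, h, ih]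
  cases n with
  | ofNat n => simpa using hnat n x
  | negSucc n =>
    rw [zpow_negSucc, zpow_negSucc, Equiv.Perm.inv_eq_iff_eq, hnat]
    simp

section Orbits

variable {α : Type*} [Fintype α] [DecidableEq α]

open Classical in
/-- The number of points in the orbit of `x` under `π`. -/
noncomputable def orbitCard (π : Equiv.Perm α) (x : α) : ℕ :=
  (Finset.univ.filter fun y => π.SameCycle x y).card

theorem orbitCard_eq_one {π : Equiv.Perm α} {x : α} (hx : π x = x) : orbitCard π x = 1 := by
  classical
  rw [orbitCard, Finset.card_eq_one]
  refine ⟨x, ?_⟩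
  ext y
  simp only [Finset.mem_filter, Finset.mem_univ, true_and, Finset.mem_singleton]
  constructor
  · rintro ⟨n, rfl⟩
    exact Equiv.Perm.zpow_apply_eq_self_of_apply_eq_self hx n
  · rintro rfl; exact Equiv.Perm.SameCycle.refl _ _

theorem orbitCard_eq_card_support {π : Equiv.Perm α} {x : α} (hx : π x ≠ x) :
    orbitCard π x = (π.cycleOf x).support.card := by
  classical
  rw [orbitCard]
  congr 1
  ext y
  simp [Equiv.Perm.mem_support_cycleOf_iff' hx]

theorem two_le_orbitCard {π : Equiv.Perm α} {x : α} (hx : π x ≠ x) : 2 ≤ orbitCard π x := by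
  rw [orbitCard_eq_card_support hx]
  exact (Equiv.Perm.isCycle_cycleOf π hx).two_le_card_support

/-- Every cycle of length `j` accounts for exactly `j` points. Orbit lengths are local, which makes
it easy to compare cycle types under restriction to invariant blocks. -/
theorem mul_count_partition (π : Equiv.Perm α) (j : ℕ) :
    j * π.partition.parts.count j = (Finset.univ.filter fun x => orbitCard π x = j).card := by
  classical
  rw [Equiv.Perm.parts_partition, Multiset.count_add, Multiset.count_replicate]
  rcases eq_or_ne j 1 with rfl | hj
  · have h1 : π.cycleType.count 1 = 0 := by
      rw [Multiset.count_eq_zero]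
      intro h
      have := Equiv.Perm.two_le_of_mem_cycleType h
      omega
    rw [h1, if_pos rfl, zero_add, one_mul, ← Finset.card_compl]
    congr 1
    ext x
    simp only [Finset.mem_compl, Equiv.Perm.mem_support, not_not, Finset.mem_filter,
      Finset.mem_univ, true_and]
    refine ⟨orbitCard_eq_one, fun h => ?_⟩
    by_contra hx
    have := two_le_orbitCard hx
    omega
  · rw [if_neg hj.symm, add_zero]
    have hmaps : ∀ x ∈ Finset.univ.filter fun x => orbitCard π x = j,
        π.cycleOf x ∈ π.cycleFactorsFinset.filter fun c => c.support.card = j := by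
      intro x hx
      rw [Finset.mem_filter] at hx
      have hx' : π x ≠ x := fun h => hj (by rw [← hx.2, orbitCard_eq_one h])
      rw [Finset.mem_filter, Equiv.Perm.cycleOf_mem_cycleFactorsFinset_iff,
        Equiv.Perm.mem_support, ← orbitCard_eq_card_support hx']
      exact ⟨hx', hx.2⟩
    rw [Finset.card_eq_sum_card_fiberwise hmaps]
    have hfib : ∀ c ∈ π.cycleFactorsFinset.filter (fun c => c.support.card = j),
        ((Finset.univ.filter fun x => orbitCard π x = j).filter
          fun x => π.cycleOf x = c).card = j := by
      intro c hc
      rw [Finset.mem_filter] at hc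
      rw [← hc.2]
      congr 1
      ext x
      simp only [Finset.mem_filter, Finset.mem_univ, true_and]
      constructor
      · rintro ⟨h1, rfl⟩
        have hx' : π x ≠ x := fun h => hj (by rw [← hc.2, ← h1, orbitCard_eq_one h])
        rw [Equiv.Perm.mem_support_cycleOf_iff' hx']
      · intro hx
        have h1 := Equiv.Perm.cycle_is_cycleOf hx hc.1
        have hx' : π x ≠ x := Equiv.Perm.mem_support.mp
          (Equiv.Perm.mem_cycleFactorsFinset_support_le hc.1 hx)
        exact ⟨by rw [orbitCard_eq_card_support hx', ← h1], h1.symm⟩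
    rw [Finset.sum_congr rfl hfib, Finset.sum_const, smul_eq_mul, mul_comm]
    congr 1
    rw [Equiv.Perm.cycleType_def, Multiset.count_map, Finset.card_def, Finset.filter_val]
    congr 1
    refine Multiset.filter_congr fun c _ => ?_
    exact eq_comm

theorem orbitCard_of_semiconj {β : Type*} [Fintype β] [DecidableEq β] {π : Equiv.Perm α}
    {σ : Equiv.Perm β} {g : β → α} (hg : Function.Injective g)
    (h : ∀ x, π (g x) = g (σ x)) (x : β) : orbitCard π (g x) = orbitCard σ x := by
  classical
  rw [orbitCard, orbitCard, ← Finset.card_image_of_injective _ hg]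
  congr 1
  ext y
  simp only [Finset.mem_filter, Finset.mem_univ, true_and, Finset.mem_image]
  constructor
  · rintro ⟨n, rfl⟩
    exact ⟨_, ⟨n, rfl⟩, (zpow_apply_of_semiconj h x n).symm⟩
  · rintro ⟨_, ⟨n, rfl⟩, rfl⟩
    exact ⟨n, zpow_apply_of_semiconj h x n⟩

theorem partition_parts_eq_sum {ι : Type*} [Fintype ι] {β : ι → Type*}
    [∀ i, Fintype (β i)] [∀ i, DecidableEq (β i)] (e : (Σ i, β i) ≃ α) {π : Equiv.Perm α}
    {σ : ∀ i, Equiv.Perm (β i)} (h : ∀ i x, π (e ⟨i, x⟩) = e ⟨i, σ i x⟩) :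
    π.partition.parts = ∑ i, (σ i).partition.parts := by
  classical
  ext j
  -- Counting points gives only `j * count j`, so `j = 0` is treated apart.
  rcases Nat.eq_zero_or_pos j with rfl | hj
  · rw [Multiset.count_eq_zero_of_notMem fun h0 => lt_irrefl 0 (π.partition.parts_pos h0),
      Multiset.count_eq_zero_of_notMem]
    intro h0
    obtain ⟨i, -, hi⟩ := Multiset.mem_sum.mp h0
    exact lt_irrefl 0 ((σ i).partition.parts_pos hi)
  · refine Nat.eq_of_mul_eq_mul_left hj ?_
    rw [Multiset.count_sum', Finset.mul_sum, mul_count_partition]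
    simp_rw [mul_count_partition]
    have h1 : (Finset.univ.filter fun x => orbitCard π x = j) =
        ((Finset.univ : Finset ι).sigma fun i => Finset.univ.filter
          fun x : β i => orbitCard (σ i) x = j).map e.toEmbedding := by
      ext x
      obtain ⟨⟨i, y⟩, rfl⟩ := e.surjective x
      have hinj : Function.Injective fun y : β i => e ⟨i, y⟩ := fun a b hab => by
        have := e.injective hab
        simpa using this
      simp [orbitCard_of_semiconj hinj (h i) y]
    rw [h1, Finset.card_map, Finset.card_sigma]

end Orbits

theorem exists_perm_partition_parts {k : ℕ} (r : Multiset ℕ) (hr : ∀ j ∈ r, 1 ≤ j)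
    (hsum : r.sum = k) : ∃ σ : Equiv.Perm (Fin k), σ.partition.parts = r := by
  have hsplit : r.filter (2 ≤ ·) + Multiset.replicate (r.count 1) 1 = r := by
    ext j
    rw [Multiset.count_add, Multiset.count_replicate, Multiset.count_filter]
    by_cases hj : j ∈ r
    · have := hr j hj
      rcases Nat.lt_or_ge j 2 with h | h
      · have : j = 1 := by omega
        subst this; simp
      · rw [if_pos h, if_neg (by omega), add_zero]
    · have := Multiset.count_eq_zero_of_notMem hj
      split_ifs with h1 h2 h2
      · omega
      · omega
      · subst h2; omega
      · omega
  have hs : (r.filter (2 ≤ ·)).sum + r.count 1 = k := by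
    have := congrArg Multiset.sum hsplit
    rw [Multiset.sum_add, Multiset.sum_replicate, smul_eq_mul, mul_one, hsum] at this
    exact this
  obtain ⟨σ, hσ⟩ := (Equiv.Perm.exists_with_cycleType_iff (Fin k) (m := r.filter (2 ≤ ·))).mpr
    ⟨by rw [Fintype.card_fin]; omega, fun a ha => (Multiset.mem_filter.mp ha).2⟩
  refine ⟨σ, ?_⟩
  rw [Equiv.Perm.parts_partition, ← Equiv.Perm.sum_cycleType, hσ, Fintype.card_fin]
  conv_rhs => rw [← hsplit]
  congr 2
  omega

/-- Forward, restrict the permutation to each invariant set. Conversely, build a block permutation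
with the prescribed cycle types; it is conjugate to `π`, and the conjugator carries the blocks to
invariant sets of `π`. -/
theorem hasFixedSets_iff {n m : ℕ} {k : Fin m → ℕ} (hk : ∑ i, k i = n) (π : Equiv.Perm (Fin n)) :
    HasFixedSets k π ↔ k ∈ rowSums m π.partition.parts := by
  classical
  constructor
  · rintro ⟨A, hcard, hdisj, hinv⟩
    have hmem : ∀ i x, π x ∈ A i ↔ x ∈ A i := by
      intro i x
      conv_lhs => rw [← hinv i]
      simp
    let f : (Σ i, {x // x ∈ A i}) → Fin n := fun p => p.2
    have hinj : Function.Injective f := by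
      rintro ⟨i, x, hx⟩ ⟨j, y, hy⟩ (rfl : x = y)
      have : i = j := by
        by_contra hij
        exact Finset.disjoint_left.mp (hdisj i j hij) hx hy
      subst this; rfl
    -- Since the sizes add up to `n`, disjointness forces the sets to cover everything.
    have hbij : Function.Bijective f := by
      rw [Fintype.bijective_iff_injective_and_card]
      refine ⟨hinj, ?_⟩
      simp [hcard, hk]
    refine ⟨fun i => (π.subtypePerm (p := fun x => x ∈ A i) (hmem i)).partition.parts, ?_, ?_⟩
    · symm
      refine partition_parts_eq_sum (Equiv.ofBijective f hbij) fun i x => ?_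
      rfl
    · intro i
      rw [Nat.Partition.parts_sum]
      simp [hcard]
  · rintro ⟨r, hr, hv⟩
    have hpos : ∀ i, ∀ j ∈ r i, 1 ≤ j := fun i j hj => π.partition.parts_pos
      (hr ▸ Multiset.mem_sum.mpr ⟨i, Finset.mem_univ i, hj⟩)
    choose σ hσ using fun i => exists_perm_partition_parts (r i) (hpos i) (hv i).symm
    have e : (Σ i, Fin (k i)) ≃ Fin n := Fintype.equivOfCardEq (by simp [hk])
    let τ : Equiv.Perm (Fin n) := e.permCongr (Equiv.Perm.sigmaCongrRight σ)
    have hτ : ∀ i x, τ (e ⟨i, x⟩) = e ⟨i, σ i x⟩ := by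
      intro i x; simp [τ, Equiv.permCongr_apply]
    have hparts : τ.partition = π.partition := by
      rw [Nat.Partition.ext_iff, partition_parts_eq_sum e hτ, ← hr]
      exact Finset.sum_congr rfl fun i _ => hσ i
    obtain ⟨c, hc⟩ := isConj_iff.mp (Equiv.Perm.partition_eq_of_isConj.mpr hparts)
    have hinj : ∀ i, Function.Injective fun x : Fin (k i) => c (e ⟨i, x⟩) := by
      intro i a b hab
      have := e.injective (c.injective hab)
      simpa using this
    have hπ : ∀ i x, π (c (e ⟨i, x⟩)) = c (e ⟨i, σ i x⟩) := by
      intro i x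
      rw [← hc, ← hτ]; simp
    refine ⟨fun i => Finset.univ.image fun x : Fin (k i) => c (e ⟨i, x⟩), fun i => ?_, ?_, ?_⟩
    · rw [Finset.card_image_of_injective _ (hinj i), Finset.card_univ, Fintype.card_fin]
    · intro i j hij
      rw [Finset.disjoint_left]
      intro y hy hy'
      simp only [Finset.mem_image, Finset.mem_univ, true_and] at hy hy'
      obtain ⟨a, rfl⟩ := hy
      obtain ⟨b, hb⟩ := hy'
      have := e.injective (c.injective hb)
      exact hij (congrArg Sigma.fst this).symm
    · intro i
      refine Finset.eq_of_subset_of_card_le ?_ ?_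
      · intro y hy
        simp only [Finset.mem_image, Finset.mem_univ, true_and] at hy ⊢
        obtain ⟨_, ⟨a, rfl⟩, rfl⟩ := hy
        exact ⟨σ i a, (hπ i a).symm⟩
      · rw [Finset.card_image_of_injective _ π.injective]

/-- Cauchy's formula. `Equiv.Perm.cycleType` omits fixed points, so their factorial is supplied by
the replicated ones. -/
theorem card_partition_mul_centralizerOrder {n : ℕ} (p : (Fintype.card (Fin n)).Partition) :
    (Finset.univ.filter fun π : Equiv.Perm (Fin n) => π.partition = p).card *
      centralizerOrder p.parts = n ! := by
  classical
  obtain ⟨g, hg⟩ := exists_perm_partition_parts p.parts (fun j hj => p.parts_pos hj)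
    (p.parts_sum.trans (Fintype.card_fin n))
  have hgp : g.partition = p := Nat.Partition.ext hg
  have h1 : (Finset.univ.filter fun π : Equiv.Perm (Fin n) => π.partition = p) =
      Finset.univ.filter fun π : Equiv.Perm (Fin n) => π.cycleType = g.cycleType := by
    ext π
    rw [Finset.mem_filter, Finset.mem_filter, ← hgp, ← Equiv.Perm.partition_eq_of_isConj,
      Equiv.Perm.isConj_iff_cycleType_eq]
  have h2 := Equiv.Perm.card_of_cycleType_mul_eq (Fin n) g.cycleType
  rw [if_pos ((Equiv.Perm.exists_with_cycleType_iff (Fin n)).mp ⟨g, rfl⟩)] at h2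
  have h3 : centralizerOrder p.parts = (Fintype.card (Fin n) - g.cycleType.sum)! *
      g.cycleType.prod * ∏ j ∈ g.cycleType.toFinset, (g.cycleType.count j)! := by
    rw [← hg, Equiv.Perm.parts_partition, Equiv.Perm.sum_cycleType, centralizerOrder_add_of_disjoint]
    · rw [mul_comm, mul_assoc, ← centralizerOrder]
      congr 1
      have h4 := centralizerOrder_replicate_add (Multiset.notMem_zero 1)
        (Fintype.card (Fin n) - g.support.card)
      rw [add_zero, one_pow, one_mul, centralizerOrder_zero, mul_one] at h4
      exact h4
    · intro j hj hj'
      have := Equiv.Perm.two_le_of_mem_cycleType hj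
      rw [Multiset.eq_of_mem_replicate hj'] at this
      omega
  rw [h1, h3, h2, Fintype.card_fin]

open Classical in
/-- The proportion of permutations with the given fixed sets as a weighted sum over cycle types. -/
theorem ofReal_fixedSetsProportion {n m : ℕ} {k : Fin m → ℕ} (hk : ∑ i, k i = n) :
    ENNReal.ofReal (fixedSetsProportion n k) =
      ∑' s, partWeight (Set.Ici 1) s * if k ∈ rowSums m s then 1 else 0 := by
  have hn0 : (n ! : ℝ≥0∞) ≠ 0 := by exact_mod_cast Nat.factorial_ne_zero n
  have hinj : Function.Injective
      (fun p : (Fintype.card (Fin n)).Partition => p.parts) := fun p q h => Nat.Partition.ext h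
  rw [← hinj.tsum_eq, tsum_fintype]
  · have h1 : Nat.card {π : Equiv.Perm (Fin n) // HasFixedSets k π} =
        ∑ p : (Fintype.card (Fin n)).Partition, if k ∈ rowSums m p.parts then
          (Finset.univ.filter fun π : Equiv.Perm (Fin n) => π.partition = p).card else 0 := by
      rw [Nat.card_eq_fintype_card, Fintype.card_subtype,
        Finset.card_eq_sum_card_fiberwise (f := fun π => π.partition) (t := Finset.univ)
          fun _ _ => Finset.mem_univ _]
      refine Finset.sum_congr rfl fun p _ => ?_
      rw [Finset.filter_filter]
      split_ifs with h
      · congr 1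
        refine Finset.filter_congr fun π _ => ?_
        rw [hasFixedSets_iff hk]
        exact ⟨fun h => h.2, fun h' => ⟨h' ▸ h, h'⟩⟩
      · rw [Finset.card_eq_zero, Finset.filter_eq_empty_iff]
        rintro π - ⟨h1, rfl⟩
        exact h ((hasFixedSets_iff hk π).mp h1)
    rw [fixedSetsProportion, h1, ENNReal.ofReal_div_of_pos (by positivity), ENNReal.ofReal_natCast,
      ENNReal.ofReal_natCast, Nat.cast_sum, ENNReal.div_eq_inv_mul, Finset.mul_sum]
    refine Finset.sum_congr rfl fun p _ => ?_
    split_ifs with h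
    · rw [partWeight_of_forall fun j hj => Set.mem_Ici.mpr (p.parts_pos hj), mul_one,
        ← card_partition_mul_centralizerOrder p]
      have hc : (Finset.univ.filter fun π : Equiv.Perm (Fin n) => π.partition = p).card ≠ 0 := by
        intro h0
        have := card_partition_mul_centralizerOrder p
        rw [h0, zero_mul] at this
        exact Nat.factorial_ne_zero n this.symm
      push_cast
      rw [ENNReal.mul_inv (Or.inr (by finiteness)) (Or.inl (by finiteness)), mul_right_comm,
        ENNReal.inv_mul_cancel (by exact_mod_cast hc) (by finiteness), one_mul]
    · simp
  · intro s hs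
    have h1 : ∀ j ∈ s, j ∈ Set.Ici 1 := by
      by_contra h
      simp [partWeight_of_not h] at hs
    have h2 : k ∈ rowSums m s := by
      by_contra h
      simp [h] at hs
    obtain ⟨r, hr, hv⟩ := h2
    refine ⟨⟨s, fun hj => h1 _ hj, ?_⟩, rfl⟩
    rw [Fintype.card_fin, ← hk, ← hr, Multiset.sum_sum]
    exact Finset.sum_congr rfl fun i _ => (hv i).symm

/-! ### Upper bound -/

/-- The sum of the square roots of the members of `s` that are at most `a`. -/
noncomputable def sqrtSum (a : ℕ) (s : Multiset ℕ) : ℝ≥0∞ :=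
  ∑ j ∈ Finset.Icc 1 a, ENNReal.ofReal (√j) * s.count j

theorem sqrtSum_cons {a j : ℕ} (hj : j ∈ Finset.Icc 1 a) (s : Multiset ℕ) :
    sqrtSum a (j ::ₘ s) = ENNReal.ofReal (√j) + sqrtSum a s := by
  have h1 : ∀ i ∈ Finset.Icc 1 a, ENNReal.ofReal (√i) * (((j ::ₘ s).count i : ℕ) : ℝ≥0∞) =
      (if i = j then ENNReal.ofReal (√j) else 0) + ENNReal.ofReal (√i) * s.count i := by
    intro i _
    rw [Multiset.count_cons]
    split_ifs with h
    · subst h; push_cast; ring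
    · simp
  rw [sqrtSum, Finset.sum_congr rfl h1, Finset.sum_add_distrib, Finset.sum_ite_eq', if_pos hj,
    sqrtSum]

theorem sum_inv_sqrt_le (a : ℕ) : ∑ j ∈ Finset.Icc 1 a, 1 / √(j : ℝ) ≤ 2 * √(a : ℝ) := by
  induction a with
  | zero => simp
  | succ a ih =>
    rw [Finset.sum_Icc_succ_top (by omega)]
    have h1 : 0 < √((a + 1 : ℕ) : ℝ) := Real.sqrt_pos.mpr (by positivity)
    have h2 : √((a + 1 : ℕ) : ℝ) ^ 2 = a + 1 := by
      rw [Real.sq_sqrt (by positivity)]; push_cast; ring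
    have h3 : √(a : ℝ) ^ 2 = a := Real.sq_sqrt (by positivity)
    have h4 : 1 / √((a + 1 : ℕ) : ℝ) ≤ 2 * √((a + 1 : ℕ) : ℝ) - 2 * √(a : ℝ) := by
      rw [div_le_iff₀ h1]
      nlinarith [sq_nonneg (√((a + 1 : ℕ) : ℝ) - √(a : ℝ))]
    linarith

/-- Expand one factor `√a + sqrtSum a s`. Stein–Chen turns `√j * count j` into the insertion of `j`
at cost `1 / √j`. As `√j ≤ √a`, the insertion at most doubles each remaining factor, and it
multiplies `numRowSums` by at most `m`. Finally, the sum of `1 / √j` is at most `2 * √a`. -/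
theorem tsum_sqrtSum_pow_succ_le (m : ℕ) {a K : ℕ} (haK : a ≤ K) (A : ℕ) :
    ∑' s, partWeight (Set.Icc 1 K) s *
        (numRowSums m s * (ENNReal.ofReal (√a) + sqrtSum a s) ^ (A + 1)) ≤
      ((1 + 2 * m * 2 ^ A : ℕ) : ℝ≥0∞) * ENNReal.ofReal (√a) *
        ∑' s, partWeight (Set.Icc 1 K) s *
          (numRowSums m s * (ENNReal.ofReal (√a) + sqrtSum a s) ^ A) := by
  set q := ENNReal.ofReal (√(a : ℝ)) with hq
  set M := ∑' s, partWeight (Set.Icc 1 K) s * (numRowSums m s * (q + sqrtSum a s) ^ A) with hM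
  have h1 : ∀ j ∈ Finset.Icc 1 a, ∑' s, ENNReal.ofReal (√j) * s.count j *
      (partWeight (Set.Icc 1 K) s * (numRowSums m s * (q + sqrtSum a s) ^ A)) ≤
      ENNReal.ofReal (1 / √j) * (m * 2 ^ A * M) := by
    intro j hj
    obtain ⟨hj1, hja⟩ := Finset.mem_Icc.mp hj
    have hj0 : (0 : ℝ) < j := by exact_mod_cast hj1
    have hsq : ENNReal.ofReal (√(j : ℝ)) = ENNReal.ofReal (1 / √j) * j := by
      rw [← ENNReal.ofReal_natCast j, ← ENNReal.ofReal_mul (by positivity)]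
      congr 1
      rw [one_div, inv_mul_eq_div, Real.div_sqrt]
    have h2 : ∑' s, ENNReal.ofReal (√j) * s.count j *
        (partWeight (Set.Icc 1 K) s * (numRowSums m s * (q + sqrtSum a s) ^ A)) =
        ENNReal.ofReal (1 / √j) * ∑' s, (s.count j : ℝ≥0∞) * j * partWeight (Set.Icc 1 K) s *
          (numRowSums m s * (q + sqrtSum a s) ^ A) := by
      rw [← ENNReal.tsum_mul_left]
      refine tsum_congr fun s => ?_
      rw [hsq]; ring
    rw [h2, tsum_count_mul_partWeight (P := Set.Icc 1 K) (j := j) ⟨hj1, hja.trans haK⟩ hj1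
      (fun s => numRowSums m s * (q + sqrtSum a s) ^ A), hM,
      ← ENNReal.tsum_mul_left (a := (m : ℝ≥0∞) * 2 ^ A)]
    refine mul_le_mul_right (ENNReal.tsum_le_tsum fun s => ?_) _
    have h3 : q + sqrtSum a (j ::ₘ s) ≤ 2 * (q + sqrtSum a s) := by
      rw [sqrtSum_cons hj]
      have : ENNReal.ofReal (√(j : ℝ)) ≤ q := by rw [hq]; gcongr
      calc q + (ENNReal.ofReal (√(j : ℝ)) + sqrtSum a s) ≤ q + (q + sqrtSum a s) := by gcongr
        _ ≤ q + (q + sqrtSum a s) + sqrtSum a s := le_self_add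
        _ = _ := by ring
    calc partWeight (Set.Icc 1 K) s *
          (numRowSums m (j ::ₘ s) * (q + sqrtSum a (j ::ₘ s)) ^ A)
        ≤ partWeight (Set.Icc 1 K) s *
          ((m * numRowSums m s) * (2 * (q + sqrtSum a s)) ^ A) := by
          gcongr
          exact numRowSums_cons_le m j s
      _ = _ := by rw [mul_pow]; ring
  have h4 : ∑' s, partWeight (Set.Icc 1 K) s * (numRowSums m s * (q + sqrtSum a s) ^ (A + 1)) =
      q * M + ∑ j ∈ Finset.Icc 1 a, ∑' s, ENNReal.ofReal (√j) * s.count j *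
        (partWeight (Set.Icc 1 K) s * (numRowSums m s * (q + sqrtSum a s) ^ A)) := by
    rw [← Summable.tsum_finsetSum fun _ _ => ENNReal.summable, hM, ← ENNReal.tsum_mul_left,
      ← ENNReal.tsum_add]
    refine tsum_congr fun s => ?_
    rw [← Finset.sum_mul, ← sqrtSum, pow_succ]
    ring
  rw [h4]
  calc _ ≤ q * M + ∑ j ∈ Finset.Icc 1 a, ENNReal.ofReal (1 / √j) * (m * 2 ^ A * M) := by
        gcongr with j hj
        exact h1 j hj
    _ = q * M + ENNReal.ofReal (∑ j ∈ Finset.Icc 1 a, 1 / √(j : ℝ)) * (m * 2 ^ A * M) := by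
        rw [← Finset.sum_mul, ENNReal.ofReal_sum_of_nonneg fun _ _ => by positivity]
    _ ≤ q * M + (2 * q) * (m * 2 ^ A * M) := by
        gcongr
        refine (ENNReal.ofReal_le_ofReal (sum_inv_sqrt_le a)).trans ?_
        rw [ENNReal.ofReal_mul (by norm_num), ENNReal.ofReal_ofNat]
    _ = _ := by push_cast; ring

/-- The constant in the moment bound `tsum_sqrtSum_pow_le`. -/
def momentConstant (m A : ℕ) : ℕ := ∏ i ∈ Finset.range A, (1 + 2 * m * 2 ^ i)

theorem tsum_sqrtSum_pow_le (m : ℕ) {a K : ℕ} (haK : a ≤ K) (A : ℕ) :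
    ∑' s, partWeight (Set.Icc 1 K) s *
        (numRowSums m s * (ENNReal.ofReal (√a) + sqrtSum a s) ^ A) ≤
      (momentConstant m A : ℝ≥0∞) * ENNReal.ofReal (√a) ^ A * smoothSum m K := by
  induction A with
  | zero => simp [momentConstant, smoothSum]
  | succ A ih =>
    refine (tsum_sqrtSum_pow_succ_le m haK A).trans ?_
    refine (mul_le_mul_right ih _).trans_eq ?_
    rw [momentConstant, momentConstant, Finset.prod_range_succ]
    push_cast
    ring

theorem ofReal_sqrt_mul_self (a : ℕ) :
    ENNReal.ofReal (√(a : ℝ)) * ENNReal.ofReal (√(a : ℝ)) = a := by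
  rw [← ENNReal.ofReal_mul (by positivity), Real.mul_self_sqrt (by positivity),
    ENNReal.ofReal_natCast]

/-- For `l < a`, each part `j ≤ l` satisfies `j ≤ √l * √j`, hence `a ≤ √l * (√a + sqrtSum a s)`;
square it. For `l ≥ a` the term `√a` alone suffices. -/
theorem inv_le_sqrtSum {a l : ℕ} (ha : 1 ≤ a) (hl : 1 ≤ l) {s : Multiset ℕ}
    (hs : ∀ j ∈ s, 1 ≤ j) (h : a ≤ l + (s.filter (· ≤ l)).sum) :
    (l : ℝ≥0∞)⁻¹ ≤ ((a : ℝ≥0∞) ^ 2)⁻¹ * (ENNReal.ofReal (√a) + sqrtSum a s) ^ 2 := by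
  have ha0 : (a : ℝ≥0∞) ≠ 0 := by simp; omega
  have hl0 : (l : ℝ≥0∞) ≠ 0 := by simp; omega
  have hlt : (l : ℝ≥0∞) ≠ ⊤ := ENNReal.natCast_ne_top l
  have ha2 : (a : ℝ≥0∞) ^ 2 ≠ 0 := pow_ne_zero 2 ha0
  have ha2t : (a : ℝ≥0∞) ^ 2 ≠ ⊤ := by finiteness
  have key : (a : ℝ≥0∞) ^ 2 ≤ l * (ENNReal.ofReal (√a) + sqrtSum a s) ^ 2 := by
    rcases Nat.lt_or_ge l a with hla | hla
    · have h1 : (((s.filter (· ≤ l)).sum : ℕ) : ℝ≥0∞) ≤ ENNReal.ofReal (√l) * sqrtSum a s := by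
        rw [sum_eq_sum_count_mul (A := Finset.Icc 1 l), sqrtSum, Finset.mul_sum]
        · push_cast
          refine (Finset.sum_le_sum fun j hj => ?_).trans (Finset.sum_le_sum_of_subset
            (Finset.Icc_subset_Icc_right hla.le))
          have hjl := (Finset.mem_Icc.mp hj).2
          rw [Multiset.count_filter_of_pos (p := (· ≤ l)) hjl]
          calc (s.count j : ℝ≥0∞) * j
              = ENNReal.ofReal (√j) * (ENNReal.ofReal (√j) * s.count j) := by
                rw [← mul_assoc, ofReal_sqrt_mul_self, mul_comm]
            _ ≤ _ := by gcongr
        · intro j hj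
          rw [Multiset.mem_filter] at hj
          exact Finset.mem_Icc.mpr ⟨hs j hj.1, hj.2⟩
      have h2 : (a : ℝ≥0∞) ≤ ENNReal.ofReal (√l) * (ENNReal.ofReal (√a) + sqrtSum a s) := by
        calc (a : ℝ≥0∞) ≤ ((l + (s.filter (· ≤ l)).sum : ℕ) : ℝ≥0∞) := by exact_mod_cast h
          _ ≤ ENNReal.ofReal (√l) * ENNReal.ofReal (√l) + ENNReal.ofReal (√l) * sqrtSum a s := by
              rw [ofReal_sqrt_mul_self, Nat.cast_add]; gcongr
          _ ≤ _ := by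
              rw [← mul_add]; gcongr
      calc (a : ℝ≥0∞) ^ 2 ≤ (ENNReal.ofReal (√l) * (ENNReal.ofReal (√a) + sqrtSum a s)) ^ 2 := by
            gcongr
        _ = _ := by rw [mul_pow, sq (ENNReal.ofReal (√l)), ofReal_sqrt_mul_self]
    · calc (a : ℝ≥0∞) ^ 2 = a * ENNReal.ofReal (√a) ^ 2 := by
            rw [sq (ENNReal.ofReal _), ofReal_sqrt_mul_self, sq]
        _ ≤ _ := by
            gcongr
            exact le_self_add
  calc (l : ℝ≥0∞)⁻¹ = ((a : ℝ≥0∞) ^ 2)⁻¹ * ((l : ℝ≥0∞)⁻¹ * (a : ℝ≥0∞) ^ 2) := by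
        rw [mul_left_comm, ENNReal.inv_mul_cancel ha2 ha2t, mul_one]
    _ ≤ ((a : ℝ≥0∞) ^ 2)⁻¹ *
        ((l : ℝ≥0∞)⁻¹ * (l * (ENNReal.ofReal (√a) + sqrtSum a s) ^ 2)) := by gcongr
    _ = _ := by rw [← mul_assoc (l : ℝ≥0∞)⁻¹, ENNReal.inv_mul_cancel hl0 hlt, one_mul]

/-- The cycle type obtained from `a` and `b` by adjoining cycles of lengths `k i - v i`, for all
`i ≠ i₀`. -/
def adjoinCycles {m : ℕ} (k : Fin m → ℕ) (i₀ : Fin m) (a : Multiset ℕ) (v : Fin m → ℕ)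
    (b : Multiset ℕ) : Multiset ℕ :=
  a + (∑ i ∈ Finset.univ.erase i₀, {k i - v i} + b)

/-- The short cycles `a`, with row sums `v`, leave room for admissible cycle lengths `k i - v i`. -/
def IsAdmissible {m : ℕ} (k : Fin m → ℕ) (c : ℕ) (i₀ i₁ : Fin m) (a : Multiset ℕ)
    (v : Fin m → ℕ) : Prop :=
  v ∈ rowSums m a ∧ i₁ ≠ i₀ ∧ v i₀ < k i₀ ∧
    ∀ i, i ≠ i₀ → v i < k i ∧ c ≤ (k i - v i) + (a.filter (· ≤ k i - v i)).sum

theorem Multiset.sum_le_sum_of_le_nat {s t : Multiset ℕ} (h : s ≤ t) : s.sum ≤ t.sum := by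
  obtain ⟨u, rfl⟩ := Multiset.le_iff_exists_add.mp h
  rw [Multiset.sum_add]; omega

/-- The removal of large cycles in the upper bound: `i₀` and `i₁` carry the largest and second
largest of the group maxima. -/
theorem exists_adjoinCycles {m : ℕ} (hm : 2 ≤ m) {k : Fin m → ℕ} {c K : ℕ} (hc : 1 ≤ c)
    (hck : ∀ i, c ≤ k i) {last : Fin m} (hK : ∀ i, i ≠ last → k i ≤ K) {s : Multiset ℕ}
    (hs : ∀ j ∈ s, 1 ≤ j) (hks : k ∈ rowSums m s) :
    ∃ (i₀ i₁ : Fin m) (a : Multiset ℕ) (v : Fin m → ℕ) (b : Multiset ℕ),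
      adjoinCycles k i₀ a v b = s ∧ IsAdmissible k c i₀ i₁ a v ∧
      (∀ j ∈ a, j ∈ Set.Icc 1 K) ∧ (∀ j ∈ b, j ∈ Set.Ioi (k i₁ - v i₁ - 1)) ∧
      b.sum = k i₀ - v i₀ := by
  obtain ⟨r, hr, hv⟩ := hks
  have hr1 : ∀ i, ∀ j ∈ r i, 1 ≤ j := fun i j hj =>
    hs j (hr ▸ Multiset.mem_sum.mpr ⟨i, Finset.mem_univ i, hj⟩)
  have hmax : ∀ i, ∃ l ∈ r i, ∀ j ∈ r i, j ≤ l := by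
    intro i
    have hne : (r i).toFinset.Nonempty := by
      rw [Multiset.toFinset_nonempty]
      intro h0
      have := hck i
      rw [hv i, h0, Multiset.sum_zero] at this
      omega
    obtain ⟨l, hl, hl'⟩ := (r i).toFinset.exists_max_image id hne
    exact ⟨l, Multiset.mem_toFinset.mp hl, fun j hj => hl' j (Multiset.mem_toFinset.mpr hj)⟩
  choose l hlr hlmax using hmax
  have hlk : ∀ i, l i ≤ k i := fun i => hv i ▸ Multiset.le_sum_of_mem (hlr i)
  obtain ⟨i₀, -, hi₀⟩ := Finset.univ.exists_max_image l ⟨last, Finset.mem_univ _⟩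
  have hne : (Finset.univ.erase i₀).Nonempty := by
    rw [← Finset.card_pos, Finset.card_erase_of_mem (Finset.mem_univ _), Finset.card_univ,
      Fintype.card_fin]
    omega
  obtain ⟨i₁, hi₁, hi₁max⟩ := (Finset.univ.erase i₀).exists_max_image l hne
  have hi₁₀ : i₁ ≠ i₀ := Finset.ne_of_mem_erase hi₁
  -- Only `k last` may exceed `K`. If `i₁ = last`, then `i₀ ≠ last` and `l i₁ ≤ l i₀ ≤ k i₀ ≤ K`.
  have hlK : l i₁ ≤ K := by
    by_cases h : i₁ = last
    · have h' : i₀ ≠ last := fun h0 => hi₁₀ (h.trans h0.symm)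
      exact (hi₀ i₁ (Finset.mem_univ _)).trans ((hlk i₀).trans (hK i₀ h'))
    · exact (hlk i₁).trans (hK i₁ h)
  let t : Fin m → Multiset ℕ := fun i =>
    if i = i₀ then (r i₀).filter (· < l i₁) else (r i).erase (l i)
  have ht₀ : t i₀ = (r i₀).filter (· < l i₁) := if_pos rfl
  have ht : ∀ i, i ≠ i₀ → t i = (r i).erase (l i) := fun i hi => if_neg hi
  set b := (r i₀).filter fun j => ¬ j < l i₁ with hb
  have hr₀ : t i₀ + b = r i₀ := by rw [ht₀, hb, Multiset.filter_add_not]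
  have hri : ∀ i, i ≠ i₀ → t i + {l i} = r i := fun i hi => by
    rw [ht i hi, add_comm, Multiset.singleton_add, Multiset.cons_erase (hlr i)]
  have hk₀ : k i₀ = (t i₀).sum + b.sum := by rw [hv i₀, ← hr₀, Multiset.sum_add]
  have hki : ∀ i, i ≠ i₀ → k i = (t i).sum + l i := fun i hi => by
    rw [hv i, ← hri i hi, Multiset.sum_add, Multiset.sum_singleton]
  have hkv : ∀ i, i ≠ i₀ → k i - (t i).sum = l i := fun i hi => by
    rw [hki i hi]; omega
  have hl1 : ∀ i, 1 ≤ l i := fun i => hr1 i _ (hlr i)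
  have htle : ∀ i, t i ≤ r i := by
    intro i
    by_cases hi : i = i₀
    · subst hi; rw [ht₀]; exact Multiset.filter_le _ _
    · rw [ht i hi]; exact Multiset.erase_le _ _
  have hbsum : 1 ≤ b.sum := by
    have h1 : l i₀ ∈ b := Multiset.mem_filter.mpr
      ⟨hlr i₀, not_lt.mpr (hi₀ i₁ (Finset.mem_univ _))⟩
    exact (hl1 i₀).trans (Multiset.le_sum_of_mem h1)
  refine ⟨i₀, i₁, ∑ i, t i, fun i => (t i).sum, b, ?_, ⟨⟨t, rfl, fun _ => rfl⟩, hi₁₀, ?_, ?_⟩,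
    ?_, ?_, ?_⟩
  · have h1 : ∑ i ∈ Finset.univ.erase i₀, ({k i - (t i).sum} : Multiset ℕ) =
        ∑ i ∈ Finset.univ.erase i₀, {l i} :=
      Finset.sum_congr rfl fun i hi => by rw [hkv i (Finset.ne_of_mem_erase hi)]
    rw [adjoinCycles, h1, ← hr, ← Finset.add_sum_erase _ t (Finset.mem_univ i₀),
      ← Finset.add_sum_erase _ r (Finset.mem_univ i₀),
      Finset.sum_congr rfl fun i hi => (hri i (Finset.ne_of_mem_erase hi)).symm,
      Finset.sum_add_distrib, ← hr₀]
    abel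
  · simp only; omega
  · intro i hi
    have h1 := hki i hi
    have h2 := hl1 i
    refine ⟨by simp only; omega, ?_⟩
    simp only [hkv i hi]
    -- What remains of group `i` consists of parts at most `l i`, so these parts and `l i` together
    -- total at least `k i ≥ c`.
    have h3 : t i ≤ (∑ i, t i).filter (· ≤ l i) := by
      rw [Multiset.le_filter]
      refine ⟨Finset.single_le_sum (f := t) (fun _ _ => Multiset.zero_le _) (Finset.mem_univ i),
        fun j hj => hlmax i j (Multiset.mem_of_le (htle i) hj)⟩
    have h4 := Multiset.sum_le_sum_of_le_nat h3
    have h5 := hck i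
    omega
  · intro j hj
    obtain ⟨i, -, hi⟩ := Multiset.mem_sum.mp hj
    have h1 := Multiset.mem_of_le (htle i) hi
    refine ⟨hr1 i j h1, ?_⟩
    by_cases hii : i = i₀
    · subst hii
      rw [ht₀] at hi
      have := (Multiset.mem_filter.mp hi).2
      omega
    · have h2 := hlmax i j h1
      have h3 := hi₁max i (Finset.mem_erase.mpr ⟨hii, Finset.mem_univ _⟩)
      omega
  · intro j hj
    have h1 := (Multiset.mem_filter.mp hj).2
    have h2 := hkv i₁ hi₁₀
    have h3 := hl1 i₁
    simp only [Set.mem_Ioi]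
    omega
  · simp only; omega

theorem prod_sum_singleton {ι : Type*} (A : Finset ι) (f : ι → ℕ) :
    (∑ i ∈ A, ({f i} : Multiset ℕ)).prod = ∏ i ∈ A, f i := by
  rw [Multiset.prod_sum]; simp

theorem inv_natCast_prod {ι : Type*} (A : Finset ι) (f : ι → ℕ) :
    ((∏ i ∈ A, f i : ℕ) : ℝ≥0∞)⁻¹ = ∏ i ∈ A, (f i : ℝ≥0∞)⁻¹ := by
  classical
  induction A using Finset.induction_on with
  | empty => simp
  | insert i A hi ih =>
    rw [Finset.prod_insert hi, Finset.prod_insert hi, Nat.cast_mul,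
      ENNReal.mul_inv (Or.inr (by finiteness)) (Or.inl (by finiteness)), ih]

theorem tsum_ite_mem_eq_ncard {α : Type*} {S : Set α} [DecidablePred (· ∈ S)] (hS : S.Finite) :
    ∑' v, (if v ∈ S then (1 : ℝ≥0∞) else 0) = (S.ncard : ℕ) := by
  rw [Set.ncard_eq_toFinset_card _ hS, tsum_eq_sum (s := hS.toFinset)
    fun v hv => if_neg fun h => hv (hS.mem_toFinset.mpr h),
    Finset.sum_congr rfl fun v hv => if_pos (hS.mem_toFinset.mp hv)]
  simp

-- Union bound over `i₀`, `i₁` and all decompositions of `s`. Summing out the tail, then `v`, leaves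
-- a moment of order `2 * m` of `√c + sqrtSum c a` against the smooth weights.
open Classical in
theorem tsum_partWeight_rowSums_le {m : ℕ} (hm : 2 ≤ m) {k : Fin m → ℕ} {c K : ℕ} (hc : 1 ≤ c)
    (hck : ∀ i, c ≤ k i) {last : Fin m} (hK : ∀ i, i ≠ last → k i ≤ K) (hcK : c ≤ K) :
    ∑' s, partWeight (Set.Ici 1) s * (if k ∈ rowSums m s then 1 else 0) ≤
      (m ^ 2 * momentConstant m (2 * m) : ℕ) * ((c : ℝ≥0∞) ^ m)⁻¹ * smoothSum m K := by
  let H : Fin m → Fin m → Multiset ℕ → (Fin m → ℕ) → Multiset ℕ → ℝ≥0∞ := fun i₀ i₁ a v b =>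
    if IsAdmissible k c i₀ i₁ a v then
      partWeight (Set.Icc 1 K) a * (∏ i ∈ Finset.univ.erase i₀, ((k i - v i : ℕ) : ℝ≥0∞)⁻¹) *
        (partWeight (Set.Ioi (k i₁ - v i₁ - 1)) b * if b.sum = k i₀ - v i₀ then 1 else 0)
    else 0
  have h1 : ∀ s, partWeight (Set.Ici 1) s * (if k ∈ rowSums m s then 1 else 0) ≤
      ∑ i₀, ∑ i₁, ∑' p : Multiset ℕ × (Fin m → ℕ) × Multiset ℕ,
        if s = adjoinCycles k i₀ p.1 p.2.1 p.2.2 then H i₀ i₁ p.1 p.2.1 p.2.2 else 0 := by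
    intro s
    by_cases hks : k ∈ rowSums m s
    swap
    · simp [hks]
    by_cases hs : ∀ j ∈ s, j ∈ Set.Ici 1
    swap
    · simp [partWeight_of_not hs]
    rw [if_pos hks, mul_one]
    obtain ⟨i₀, i₁, a, v, b, hab, hadm, ha, hb, hbs⟩ := exists_adjoinCycles hm hc hck hK hs hks
    have hle : partWeight (Set.Ici 1) s ≤ H i₀ i₁ a v b := by
      simp only [H]
      rw [if_pos hadm, if_pos hbs, partWeight_of_forall hs, partWeight_of_forall ha,
        partWeight_of_forall hb, mul_one, ← inv_natCast_prod,
        ← ENNReal.mul_inv (Or.inr (by finiteness)) (Or.inl (by finiteness)),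
        ← ENNReal.mul_inv (Or.inr (by finiteness)) (Or.inl (by finiteness)), ENNReal.inv_le_inv]
      have h2 := (Nat.mul_le_mul_left (centralizerOrder a) (Nat.mul_le_mul_right
        (centralizerOrder b) ((prod_sum_singleton (Finset.univ.erase i₀) fun i => k i - v i).symm.le.trans
        (prod_le_centralizerOrder _)))).trans ((Nat.mul_le_mul_left _
        (centralizerOrder_mul_le _ _)).trans (centralizerOrder_mul_le _ _))
      rw [← hab, adjoinCycles]
      rw [← mul_assoc] at h2
      exact_mod_cast h2
    refine hle.trans ?_
    refine le_trans ?_ (Finset.single_le_sum (fun _ _ => zero_le) (Finset.mem_univ i₀))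
    refine le_trans ?_ (Finset.single_le_sum (fun _ _ => zero_le) (Finset.mem_univ i₁))
    refine le_trans ?_ (ENNReal.le_tsum (a, v, b))
    rw [if_pos hab.symm]
  have h2 : ∀ i₀ i₁, ∑' p : Multiset ℕ × (Fin m → ℕ) × Multiset ℕ, H i₀ i₁ p.1 p.2.1 p.2.2 ≤
      momentConstant m (2 * m) * ((c : ℝ≥0∞) ^ m)⁻¹ * smoothSum m K := by
    intro i₀ i₁
    have hc0 : (c : ℝ≥0∞) ^ m ≠ 0 := pow_ne_zero _ (by simp; omega)
    have hct : (c : ℝ≥0∞) ^ m ≠ ⊤ := by finiteness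
    -- The `m - 1` forced cycles and the rough tail give `m` reciprocal lengths, each bounded by
    -- `inv_le_sqrtSum`.
    have h3 : ∀ a v, ∑' b, H i₀ i₁ a v b ≤ (if v ∈ rowSums m a then 1 else 0) *
        (partWeight (Set.Icc 1 K) a *
        (((c : ℝ≥0∞) ^ 2)⁻¹ * (ENNReal.ofReal (√c) + sqrtSum c a) ^ 2) ^ m) := by
      intro a v
      by_cases hadm : IsAdmissible k c i₀ i₁ a v
      swap
      · simp [H, hadm]
      by_cases ha : ∀ j ∈ a, j ∈ Set.Icc 1 K
      swap
      · simp [H, partWeight_of_not ha]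
      obtain ⟨hv, hi, hv₀, hvi⟩ := hadm
      simp only [H]
      simp_rw [if_pos (show IsAdmissible k c i₀ i₁ a v from ⟨hv, hi, hv₀, hvi⟩)]
      rw [ENNReal.tsum_mul_left, ← roughProportion, if_pos hv, one_mul, mul_assoc]
      refine mul_le_mul_right ?_ _
      have h4 : ∀ i, i ≠ i₀ → ((k i - v i : ℕ) : ℝ≥0∞)⁻¹ ≤
          ((c : ℝ≥0∞) ^ 2)⁻¹ * (ENNReal.ofReal (√c) + sqrtSum c a) ^ 2 := fun i hi' =>
        inv_le_sqrtSum hc (by have := (hvi i hi').1; omega) (fun j hj => (ha j hj).1)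
          (hvi i hi').2
      have h5 : roughProportion (k i₁ - v i₁ - 1) (k i₀ - v i₀) ≤
          ((c : ℝ≥0∞) ^ 2)⁻¹ * (ENNReal.ofReal (√c) + sqrtSum c a) ^ 2 := by
        refine le_trans ?_ (h4 i₁ hi)
        refine (roughProportion_le _ (by omega)).trans_eq ?_
        have := (hvi i₁ hi).1
        rw [← Nat.cast_add_one, Nat.sub_add_cancel (by omega)]
      calc _ ≤ (∏ i ∈ Finset.univ.erase i₀,
            (((c : ℝ≥0∞) ^ 2)⁻¹ * (ENNReal.ofReal (√c) + sqrtSum c a) ^ 2)) *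
            (((c : ℝ≥0∞) ^ 2)⁻¹ * (ENNReal.ofReal (√c) + sqrtSum c a) ^ 2) := by
            refine mul_le_mul' (Finset.prod_le_prod' fun i hi' => ?_) h5
            exact h4 i (Finset.ne_of_mem_erase hi')
        _ = _ := by
            rw [Finset.prod_const, Finset.card_erase_of_mem (Finset.mem_univ _), Finset.card_univ,
              Fintype.card_fin, ← pow_succ, Nat.sub_add_cancel (by omega)]
    calc _ = ∑' a, ∑' v, ∑' b, H i₀ i₁ a v b := by
          rw [ENNReal.tsum_prod']
          exact tsum_congr fun a => ENNReal.tsum_prod'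
      _ ≤ ∑' a, ∑' v, (if v ∈ rowSums m a then 1 else 0) * (partWeight (Set.Icc 1 K) a *
          (((c : ℝ≥0∞) ^ 2)⁻¹ * (ENNReal.ofReal (√c) + sqrtSum c a) ^ 2) ^ m) :=
          ENNReal.tsum_le_tsum fun a => ENNReal.tsum_le_tsum fun v => h3 a v
      _ = (((c : ℝ≥0∞) ^ 2)⁻¹) ^ m * ∑' a, partWeight (Set.Icc 1 K) a *
          (numRowSums m a * (ENNReal.ofReal (√c) + sqrtSum c a) ^ (2 * m)) := by
          rw [← ENNReal.tsum_mul_left]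
          refine tsum_congr fun a => ?_
          rw [ENNReal.tsum_mul_right, tsum_ite_mem_eq_ncard (rowSums_finite m a), ← numRowSums,
            mul_pow, pow_mul]
          ring
      _ ≤ (((c : ℝ≥0∞) ^ 2)⁻¹) ^ m *
          (momentConstant m (2 * m) * ENNReal.ofReal (√c) ^ (2 * m) * smoothSum m K) := by
          gcongr
          exact tsum_sqrtSum_pow_le m hcK (2 * m)
      -- The moment contributes `c ^ m` against `c ^ (-2 * m)`, leaving `c ^ (-m)`.
      _ = _ := by
          have hinv : (c : ℝ≥0∞)⁻¹ ^ m * (c : ℝ≥0∞) ^ m = 1 := by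
            rw [← ENNReal.inv_pow, ENNReal.inv_mul_cancel hc0 hct]
          rw [pow_mul (ENNReal.ofReal _), sq (ENNReal.ofReal _), ofReal_sqrt_mul_self,
            ENNReal.inv_pow, ENNReal.inv_pow]
          calc _ = momentConstant m (2 * m) * (c : ℝ≥0∞)⁻¹ ^ m *
                ((c : ℝ≥0∞)⁻¹ ^ m * (c : ℝ≥0∞) ^ m) * smoothSum m K := by ring
            _ = _ := by rw [hinv, mul_one]
  calc _ ≤ ∑' s, ∑ i₀, ∑ i₁, ∑' p : Multiset ℕ × (Fin m → ℕ) × Multiset ℕ,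
        (if s = adjoinCycles k i₀ p.1 p.2.1 p.2.2 then H i₀ i₁ p.1 p.2.1 p.2.2 else 0) :=
        ENNReal.tsum_le_tsum h1
    _ = ∑ i₀, ∑ i₁, ∑' p : Multiset ℕ × (Fin m → ℕ) × Multiset ℕ, H i₀ i₁ p.1 p.2.1 p.2.2 := by
        rw [Summable.tsum_finsetSum fun _ _ => ENNReal.summable]
        refine Finset.sum_congr rfl fun i₀ _ => ?_
        rw [Summable.tsum_finsetSum fun _ _ => ENNReal.summable]
        refine Finset.sum_congr rfl fun i₁ _ => ?_
        rw [ENNReal.tsum_comm]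
        refine tsum_congr fun p => ?_
        rw [tsum_ite_eq]
    _ ≤ ∑ i₀ : Fin m, ∑ i₁ : Fin m,
        momentConstant m (2 * m) * ((c : ℝ≥0∞) ^ m)⁻¹ * smoothSum m K :=
        Finset.sum_le_sum fun i₀ _ => Finset.sum_le_sum fun i₁ _ => h2 i₀ i₁
    _ = _ := by
        simp only [Finset.sum_const, Finset.card_univ, Fintype.card_fin, nsmul_eq_mul]
        push_cast
        ring

/-! ### Lower bound -/

theorem sum_eq_of_mem_rowSums {m : ℕ} {a : Multiset ℕ} {v : Fin m → ℕ} (h : v ∈ rowSums m a) :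
    ∑ i, v i = a.sum := by
  obtain ⟨r, rfl, hv⟩ := h
  rw [Multiset.sum_sum]
  exact Finset.sum_congr rfl fun i _ => hv i

/-- By Stein–Chen, each `j ≤ M` contributes at most `m` to the mean total size under the weights
tilted by `numRowSums`. -/
theorem tsum_sum_mul_numRowSums_le (m M : ℕ) :
    ∑' s : Multiset ℕ, partWeight (Set.Icc 1 M) s * (numRowSums m s * (s.sum : ℕ)) ≤
      (m * M : ℕ) * smoothSum m M := by
  have h1 : ∀ s : Multiset ℕ, partWeight (Set.Icc 1 M) s * (numRowSums m s * (s.sum : ℕ)) =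
      ∑ j ∈ Finset.Icc 1 M, (s.count j : ℝ≥0∞) * j * partWeight (Set.Icc 1 M) s *
        numRowSums m s := by
    intro s
    by_cases h : ∀ j ∈ s, j ∈ Set.Icc 1 M
    · rw [sum_eq_sum_count_mul s (A := Finset.Icc 1 M) fun j hj => Finset.mem_Icc.mpr (h j hj),
        Nat.cast_sum, Finset.mul_sum, Finset.mul_sum]
      refine Finset.sum_congr rfl fun j _ => ?_
      push_cast; ring
    · simp [partWeight_of_not h]
  rw [tsum_congr h1, Summable.tsum_finsetSum fun _ _ => ENNReal.summable]
  calc _ ≤ ∑ j ∈ Finset.Icc 1 M, (m : ℝ≥0∞) * smoothSum m M := by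
        refine Finset.sum_le_sum fun j hj => ?_
        have hj' := Finset.mem_Icc.mp hj
        rw [tsum_count_mul_partWeight (P := Set.Icc 1 M) hj' hj'.1, smoothSum,
          ← ENNReal.tsum_mul_left]
        refine ENNReal.tsum_le_tsum fun s => ?_
        rw [mul_left_comm]
        exact mul_le_mul_right (numRowSums_cons_le m j s) _
    _ = _ := by
        rw [Finset.sum_const, Nat.card_Icc, nsmul_eq_mul, Nat.add_sub_cancel]
        push_cast; ring

/-- Small total size costs at most a factor `2`. -/
theorem smoothSum_le_two_mul {m M c : ℕ} (hc : 1 ≤ c) (hM : 4 * (m * M) ≤ c) :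
    smoothSum m M ≤ 2 * ∑' s : Multiset ℕ, partWeight (Set.Icc 1 M) s *
      (numRowSums m s * if 2 * s.sum ≤ c then 1 else 0) := by
  set good := ∑' s : Multiset ℕ, partWeight (Set.Icc 1 M) s *
      (numRowSums m s * if 2 * s.sum ≤ c then 1 else 0) with hgood
  set bad := ∑' s : Multiset ℕ, partWeight (Set.Icc 1 M) s *
      (numRowSums m s * if 2 * s.sum ≤ c then 0 else 1) with hbad
  have hsum : smoothSum m M = good + bad := by
    rw [hgood, hbad, ← ENNReal.tsum_add, smoothSum]
    refine tsum_congr fun s => ?_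
    split_ifs <;> simp
  have hc0 : (c : ℝ≥0∞) ≠ 0 := by simp; omega
  have h1 : (c : ℝ≥0∞) * bad ≤ 2 * ((m * M : ℕ) * smoothSum m M) := by
    refine le_trans ?_ (mul_le_mul_right (tsum_sum_mul_numRowSums_le m M) 2)
    rw [hbad, ← ENNReal.tsum_mul_left, ← ENNReal.tsum_mul_left]
    refine ENNReal.tsum_le_tsum fun s => ?_
    split_ifs with h
    · simp
    · have h2 : (c : ℝ≥0∞) ≤ 2 * (s.sum : ℕ) := by exact_mod_cast (not_le.mp h).le
      calc (c : ℝ≥0∞) * (partWeight (Set.Icc 1 M) s * (numRowSums m s * 1))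
          ≤ (2 * (s.sum : ℕ)) * (partWeight (Set.Icc 1 M) s * (numRowSums m s * 1)) := by gcongr
        _ = _ := by ring
  -- Markov's inequality: as `4 * (m * M) ≤ c`, totals above `c / 2` carry at most half of the mass.
  have h2 : 2 * bad ≤ smoothSum m M := by
    rw [← ENNReal.mul_le_mul_iff_right hc0 (ENNReal.natCast_ne_top c)]
    calc (c : ℝ≥0∞) * (2 * bad) = 2 * (c * bad) := by ring
      _ ≤ 2 * (2 * ((m * M : ℕ) * smoothSum m M)) := by gcongr
      _ = ((4 * (m * M) : ℕ) : ℝ≥0∞) * smoothSum m M := by push_cast; ring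
      _ ≤ _ := by gcongr
  have hbt : bad ≠ ⊤ := ne_top_of_le_ne_top (smoothSum_ne_top m M) (hsum ▸ le_add_self)
  have h3 : bad ≤ good := by
    rw [hsum, two_mul] at h2
    exact (ENNReal.add_le_add_iff_right hbt).mp h2
  rw [hsum, two_mul]
  gcongr

theorem smoothSum_le_smoothSum_div {m c : ℕ} (hm : 1 ≤ m) (hc : 1 ≤ c) :
    smoothSum m c ≤ ((12 * m) ^ m : ℕ) * smoothSum m (c / (4 * m)) := by
  -- If `c < 4 * m` the quotient is `0` and the ratio bound is unavailable; the loss is then at most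
  -- `(c * exp 1) ^ m ≤ (12 * m) ^ m`, whence the constant.
  rcases Nat.eq_zero_or_pos (c / (4 * m)) with h | h
  · have hcm : c < 4 * m := (Nat.div_eq_zero_iff_lt (by omega)).mp h
    rw [h]
    calc smoothSum m c ≤ ENNReal.ofReal (((c : ℝ) / (1 : ℕ)) ^ m) * smoothSum m 1 :=
          smoothSum_le_of_le m le_rfl hc
      _ ≤ ENNReal.ofReal (((c : ℝ) / (1 : ℕ)) ^ m) *
          (ENNReal.ofReal (Real.exp (m / (0 + 1 : ℕ))) * smoothSum m 0) := by
          gcongr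
          exact smoothSum_succ_le m 0
      _ = ENNReal.ofReal ((c : ℝ) ^ m * Real.exp 1 ^ m) * smoothSum m 0 := by
          rw [← mul_assoc, ← ENNReal.ofReal_mul (by positivity), ← Real.exp_nat_mul]
          simp
      _ ≤ _ := by
          gcongr
          rw [← ENNReal.ofReal_natCast]
          gcongr
          push_cast
          rw [← mul_pow]
          refine pow_le_pow_left₀ (by positivity) ?_ m
          have h1 : (c : ℝ) ≤ 4 * m := by exact_mod_cast hcm.le
          have h2 := Real.exp_one_lt_d9
          calc (c : ℝ) * Real.exp 1 ≤ (4 * m) * 3 := by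
                gcongr
                linarith
            _ = _ := by ring
  · have h1 : c ≤ 12 * m * (c / (4 * m)) := by
      have h2 := Nat.lt_div_mul_add (a := c) (b := 4 * m) (by omega)
      have h3 : 4 * m ≤ c / (4 * m) * (4 * m) := Nat.le_mul_of_pos_left _ h
      nlinarith
    refine (smoothSum_le_of_le m h (Nat.div_le_self _ _)).trans ?_
    gcongr
    rw [← ENNReal.ofReal_natCast]
    gcongr
    push_cast
    gcongr
    rw [div_le_iff₀ (by exact_mod_cast h)]
    exact_mod_cast h1

/-- The conditions under which `adjoinCycles k last a v b` is a cycle type with only short cycles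
in `a`, only long cycles in `b`, and intermediate adjoined cycles. -/
structure IsSeparated {m : ℕ} (k : Fin m → ℕ) (c M K : ℕ) (last : Fin m) (a : Multiset ℕ)
    (v : Fin m → ℕ) (b : Multiset ℕ) : Prop where
  mem : v ∈ rowSums m a
  small : 2 * a.sum ≤ c
  parts : ∀ j ∈ a, j ∈ Set.Icc 1 M
  tail : (K < k last - v last ∧ (∀ j ∈ b, j ∈ Set.Ioi K) ∧ b.sum = k last - v last) ∨
    (k last - v last ≤ K ∧ b = {k last - v last})

namespace IsSeparated

variable {m : ℕ} {k : Fin m → ℕ} {c M K : ℕ} {last : Fin m} {a : Multiset ℕ}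
    {v : Fin m → ℕ} {b : Multiset ℕ}

theorem two_mul_le (h : IsSeparated k c M K last a v b) (i : Fin m) : 2 * v i ≤ c := by
  have h1 := sum_eq_of_mem_rowSums h.mem
  have h2 : v i ≤ ∑ i, v i := Finset.single_le_sum (fun _ _ => Nat.zero_le _) (Finset.mem_univ i)
  have := h.small
  omega

theorem sum_tail (h : IsSeparated k c M K last a v b) : b.sum = k last - v last := by
  rcases h.tail with h | h
  · exact h.2.2
  · rw [h.2, Multiset.sum_singleton]

theorem lt_sub (h : IsSeparated k c M K last a v b) (hc : 1 ≤ c) (hM : 4 * M ≤ c)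
    (hck : ∀ i, c ≤ k i) (i : Fin m) : v i < k i ∧ M < k i - v i := by
  have h1 := h.two_mul_le i
  have h2 := hck i
  omega

theorem lt_of_mem_tail (h : IsSeparated k c M K last a v b) (hc : 1 ≤ c) (hM : 4 * M ≤ c)
    (hck : ∀ i, c ≤ k i) (hMK : M ≤ K) {j : ℕ} (hj : j ∈ b) : M < j := by
  rcases h.tail with ht | ht
  · exact hMK.trans_lt (ht.2.1 j hj)
  · rw [ht.2, Multiset.mem_singleton] at hj
    rw [hj]
    exact (h.lt_sub hc hM hck last).2

theorem mem_adjoined {i₀ : Fin m} {j : ℕ}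
    (hj : j ∈ ∑ i ∈ Finset.univ.erase i₀, ({k i - v i} : Multiset ℕ)) :
    ∃ i, i ≠ i₀ ∧ j = k i - v i := by
  obtain ⟨i, hi, hi'⟩ := Multiset.mem_sum.mp hj
  exact ⟨i, Finset.ne_of_mem_erase hi, Multiset.mem_singleton.mp hi'⟩

theorem mem_rowSums (h : IsSeparated k c M K last a v b) (hck : ∀ i, c ≤ k i) :
    k ∈ rowSums m (adjoinCycles k last a v b) := by
  obtain ⟨r, hr, hv⟩ := h.mem
  refine ⟨fun i => r i + if i = last then b else {k i - v i}, ?_, fun i => ?_⟩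
  · rw [Finset.sum_add_distrib, hr, adjoinCycles,
      ← Finset.add_sum_erase _ _ (Finset.mem_univ last), if_pos rfl, add_comm b]
    congr 2
    exact Finset.sum_congr rfl fun i hi => if_neg (Finset.ne_of_mem_erase hi)
  · have h1 := h.two_mul_le i
    have h2 := hck i
    rw [Multiset.sum_add, ← hv i]
    split_ifs with hi
    · subst hi; rw [h.sum_tail]; omega
    · rw [Multiset.sum_singleton]; omega

/-- The cycle type determines `a`, as its parts at most `M`; this begins the bound on the
multiplicity of the construction. -/
theorem filter_le (h : IsSeparated k c M K last a v b) (hc : 1 ≤ c) (hM : 4 * M ≤ c)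
    (hck : ∀ i, c ≤ k i) (hMK : M ≤ K) : (adjoinCycles k last a v b).filter (· ≤ M) = a := by
  rw [adjoinCycles, Multiset.filter_add, Multiset.filter_add,
    Multiset.filter_eq_self.mpr fun j hj => (h.parts j hj).2,
    Multiset.filter_eq_nil.mpr, Multiset.filter_eq_nil.mpr, add_zero, add_zero]
  · intro j hj
    exact not_le.mpr (h.lt_of_mem_tail hc hM hck hMK hj)
  · intro j hj
    obtain ⟨i, -, rfl⟩ := mem_adjoined hj
    exact not_le.mpr (h.lt_sub hc hM hck i).2

theorem one_le_of_mem (h : IsSeparated k c M K last a v b) (hc : 1 ≤ c) (hM : 4 * M ≤ c)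
    (hck : ∀ i, c ≤ k i) (hMK : M ≤ K) {j : ℕ} (hj : j ∈ adjoinCycles k last a v b) : 1 ≤ j := by
  rw [adjoinCycles, Multiset.mem_add, Multiset.mem_add] at hj
  rcases hj with hj | hj | hj
  · exact (h.parts j hj).1
  · obtain ⟨i, -, rfl⟩ := mem_adjoined hj
    have := (h.lt_sub hc hM hck i).2
    omega
  · have := h.lt_of_mem_tail hc hM hck hMK hj
    omega

theorem card_filter_le (h : IsSeparated k c M K last a v b) (hm : 1 ≤ m) :
    ((adjoinCycles k last a v b).filter fun j => M < j ∧ j ≤ K).card ≤ m := by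
  have h1 : a.filter (fun j => M < j ∧ j ≤ K) = 0 := by
    rw [Multiset.filter_eq_nil]
    intro j hj
    have := (h.parts j hj).2
    omega
  have h2 : (b.filter fun j => M < j ∧ j ≤ K).card ≤ 1 := by
    rcases h.tail with ht | ht
    · rw [Multiset.filter_eq_nil.mpr, Multiset.card_zero]
      · omega
      · intro j hj
        have := ht.2.1 j hj
        simp only [Set.mem_Ioi] at this
        omega
    · refine (Multiset.card_le_card (Multiset.filter_le _ _)).trans ?_
      rw [ht.2, Multiset.card_singleton]
  have h3 : (((∑ i ∈ Finset.univ.erase last, ({k i - v i} : Multiset ℕ))).filter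
      fun j => M < j ∧ j ≤ K).card ≤ m - 1 := by
    refine (Multiset.card_le_card (Multiset.filter_le _ _)).trans ?_
    rw [Multiset.card_sum]
    simp [Finset.card_erase_of_mem]
  rw [adjoinCycles, Multiset.filter_add, Multiset.filter_add, h1, zero_add, Multiset.card_add]
  omega

/-- The parts of `a` are shorter than all others, so the orders multiply there. An adjoined length
occurs at most once in `b`, so coincidences cost at most `m ^ (m - 1)`. -/
theorem centralizerOrder_le (h : IsSeparated k c M K last a v b) (hm : 1 ≤ m) (hc : 1 ≤ c)
    (hM : 4 * M ≤ c) (hck : ∀ i, c ≤ k i) (hMK : M ≤ K) (hK : ∀ i, i ≠ last → k i ≤ K) :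
    centralizerOrder (adjoinCycles k last a v b) ≤
      m ^ m * (centralizerOrder a * (∏ i ∈ Finset.univ.erase last, (k i - v i)) *
        centralizerOrder b) := by
  rw [adjoinCycles, centralizerOrder_add_of_disjoint]
  · have h1 := centralizerOrder_add_le (B := 1) (b := b)
      (t := ∑ i ∈ Finset.univ.erase last, ({k i - v i} : Multiset ℕ)) fun j hj => by
        obtain ⟨i, hi, rfl⟩ := mem_adjoined hj
        rcases h.tail with ht | ht
        · rw [Multiset.count_eq_zero_of_notMem]
          · omega
          · intro hb
            have h2 := ht.2.1 _ hb
            have h3 := hK i hi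
            simp only [Set.mem_Ioi] at h2
            omega
        · rw [ht.2]
          exact (Multiset.count_le_card _ _).trans_eq (Multiset.card_singleton _)
    have hcard : (∑ i ∈ Finset.univ.erase last, ({k i - v i} : Multiset ℕ)).card = m - 1 := by
      rw [Multiset.card_sum]
      simp [Finset.card_erase_of_mem]
    rw [hcard, prod_sum_singleton, Nat.sub_add_cancel hm] at h1
    calc _ ≤ centralizerOrder a * ((∏ i ∈ Finset.univ.erase last, (k i - v i)) *
          centralizerOrder b * m ^ m) := by
          refine Nat.mul_le_mul_left _ (h1.trans (Nat.mul_le_mul_left _ ?_))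
          exact Nat.pow_le_pow_right hm (by omega)
      _ = _ := by ring
  · intro j hj hj'
    have h2 := (h.parts j hj).2
    rcases Multiset.mem_add.mp hj' with hj' | hj'
    · obtain ⟨i, -, rfl⟩ := mem_adjoined hj'
      have := (h.lt_sub hc hM hck i).2
      omega
    · have := h.lt_of_mem_tail hc hM hck hMK hj'
      omega

theorem eq_of_adjoinCycles_eq (h : IsSeparated k c M K last a v b) (hc : 1 ≤ c) (hM : 4 * M ≤ c)
    (hck : ∀ i, c ≤ k i) (hMK : M ≤ K) {a' : Multiset ℕ} {v' : Fin m → ℕ} {b' : Multiset ℕ}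
    (h' : IsSeparated k c M K last a' v' b')
    (heq : adjoinCycles k last a v b = adjoinCycles k last a' v' b')
    (hv : ∀ i, i ≠ last → k i - v i = k i - v' i) : a = a' ∧ v = v' ∧ b = b' := by
  have ha : a = a' := by
    rw [← h.filter_le hc hM hck hMK, heq, h'.filter_le hc hM hck hMK]
  subst ha
  have hvi : ∀ i, i ≠ last → v i = v' i := fun i hi => by
    have h1 := hv i hi
    have h2 := h.lt_sub hc hM hck i
    have h3 := h'.lt_sub hc hM hck i
    omega
  have hvv : v = v' := by
    -- The coordinate `last` is recovered from the others because the total of `v` is `a.sum`.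
    funext i
    by_cases hi : i = last
    · subst hi
      have h1 := (sum_eq_of_mem_rowSums h.mem).trans (sum_eq_of_mem_rowSums h'.mem).symm
      rw [← Finset.add_sum_erase _ _ (Finset.mem_univ i),
        ← Finset.add_sum_erase _ v' (Finset.mem_univ i),
        Finset.sum_congr rfl fun i' hi' => hvi i' (Finset.ne_of_mem_erase hi')] at h1
      exact Nat.add_right_cancel h1
    · exact hvi i hi
  subst hvv
  refine ⟨rfl, rfl, ?_⟩
  rw [adjoinCycles, adjoinCycles] at heq
  exact add_left_cancel (add_left_cancel heq)

end IsSeparated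

/-- If `K < N`, rough cycle types suffice. If `N ≤ K`, a tail of parts above `K` cannot have total
`N` for positive `N`, and the single cycle `N` with weight `1 / N` takes over. -/
theorem le_tsum_tail {K N : ℕ} {p : Multiset ℕ → Prop} [DecidablePred p]
    (hp : ∀ b, ((K < N ∧ (∀ j ∈ b, j ∈ Set.Ioi K) ∧ b.sum = N) ∨ (N ≤ K ∧ b = {N})) → p b) :
    (2 * (K : ℝ≥0∞) + 1)⁻¹ ≤ ∑' b, if p b then ((centralizerOrder b : ℕ) : ℝ≥0∞)⁻¹ else 0 := by
  rcases Nat.lt_or_ge K N with h | h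
  · refine (le_roughProportion N h).trans (ENNReal.tsum_le_tsum fun b => ?_)
    by_cases hb : ∀ j ∈ b, j ∈ Set.Ioi K
    · by_cases hs : b.sum = N
      · rw [if_pos hs, mul_one, partWeight_of_forall hb, if_pos (hp b (Or.inl ⟨h, hb, hs⟩))]
      · simp [hs]
    · simp [partWeight_of_not hb]
  · refine le_trans ?_ (ENNReal.le_tsum {N})
    rw [if_pos (hp _ (Or.inr ⟨h, rfl⟩)), ENNReal.inv_le_inv]
    have h1 : centralizerOrder {N} = N := by
      have := centralizerOrder_cons N 0
      simpa [centralizerOrder_zero] using this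
    rw [h1]
    have : N ≤ 2 * K + 1 := by omega
    exact_mod_cast this

-- Double counting over triples `(a, v, b)`: bounded fibres of `Φ` bound the total weight above, and
-- summing out `b`, then `v`, bounds it below by the smooth sum over small totals.
open Classical in
theorem smoothSum_le_tsum_partWeight_rowSums {m : ℕ} (hm : 1 ≤ m) {k : Fin m → ℕ} {c M K : ℕ}
    (hc : 1 ≤ c) (hM : 4 * (m * M) ≤ c) (hck : ∀ i, c ≤ k i) {last : Fin m}
    (hK : ∀ i, i ≠ last → k i ≤ K) (hcK : c ≤ K) :
    smoothSum m M ≤ (2 * (3 * K) ^ m * (m ^ m * (m + 1) ^ m) : ℕ) *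
      ∑' s, partWeight (Set.Ici 1) s * (if k ∈ rowSums m s then 1 else 0) := by
  have hM' : 4 * M ≤ c := le_trans (Nat.mul_le_mul_left 4 (Nat.le_mul_of_pos_left M hm)) hM
  have hMK : M ≤ K := by omega
  set T := ∑' s, partWeight (Set.Ici 1) s * (if k ∈ rowSums m s then (1 : ℝ≥0∞) else 0) with hT
  let Φ : Multiset ℕ × (Fin m → ℕ) × Multiset ℕ → Multiset ℕ :=
    fun p => adjoinCycles k last p.1 p.2.1 p.2.2
  let Q : Multiset ℕ × (Fin m → ℕ) × Multiset ℕ → Prop :=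
    fun p => IsSeparated k c M K last p.1 p.2.1 p.2.2
  let H : Multiset ℕ × (Fin m → ℕ) × Multiset ℕ → ℝ≥0∞ := fun p =>
    if Q p then ((centralizerOrder p.1 : ℕ) : ℝ≥0∞)⁻¹ *
      (∏ i ∈ Finset.univ.erase last, ((k i - p.2.1 i : ℕ) : ℝ≥0∞)⁻¹) *
        ((centralizerOrder p.2.2 : ℕ) : ℝ≥0∞)⁻¹ else 0
  have hfib : ∀ s, ({p | Φ p = s ∧ Q p}).Finite ∧ ({p | Φ p = s ∧ Q p}).ncard ≤ (m + 1) ^ m := by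
    intro s
    -- A triple in the fibre is determined by its adjoined lengths, which lie among the at most `m`
    -- parts of `s` in `(M, K]`; the value `0` fills the coordinate `last`.
    let U : Finset ℕ := insert 0 (s.filter fun j => M < j ∧ j ≤ K).toFinset
    let V : Finset (Fin m → ℕ) := Fintype.piFinset fun _ => U
    let g : Multiset ℕ × (Fin m → ℕ) × Multiset ℕ → (Fin m → ℕ) :=
      fun p i => if i = last then 0 else k i - p.2.1 i
    have hmaps : Set.MapsTo g {p | Φ p = s ∧ Q p} (V : Set (Fin m → ℕ)) := by
      rintro p ⟨hp, hq⟩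
      rw [Finset.mem_coe, Fintype.mem_piFinset]
      intro i
      by_cases hi : i = last
      · simp [g, U, hi]
      · simp only [g, U, if_neg hi, Finset.mem_insert, Multiset.mem_toFinset, Multiset.mem_filter]
        refine Or.inr ⟨?_, (hq.lt_sub hc hM' hck i).2, (Nat.sub_le _ _).trans (hK i hi)⟩
        rw [← hp]
        refine Multiset.mem_add.mpr (Or.inr (Multiset.mem_add.mpr (Or.inl ?_)))
        exact Multiset.mem_sum.mpr ⟨i, Finset.mem_erase.mpr ⟨hi, Finset.mem_univ i⟩,
          Multiset.mem_singleton_self _⟩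
    have hinj : Set.InjOn g {p | Φ p = s ∧ Q p} := by
      rintro ⟨a, v, b⟩ ⟨hp, hq⟩ ⟨a', v', b'⟩ ⟨hp', hq'⟩ hg
      obtain ⟨rfl, rfl, rfl⟩ := hq.eq_of_adjoinCycles_eq hc hM' hck hMK hq' (hp.trans hp'.symm)
        fun i hi => by simpa [g, hi] using congrFun hg i
      rfl
    refine ⟨Set.Finite.of_injOn hmaps hinj V.finite_toSet, ?_⟩
    rcases Set.eq_empty_or_nonempty {p | Φ p = s ∧ Q p} with hE | ⟨p, hp, hq⟩
    · rw [hE, Set.ncard_empty]; exact Nat.zero_le _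
    · refine (Set.ncard_le_ncard_of_injOn g hmaps hinj V.finite_toSet).trans ?_
      rw [Set.ncard_coe_finset, Fintype.card_piFinset, Finset.prod_const, Finset.card_univ,
        Fintype.card_fin]
      refine Nat.pow_le_pow_left ((Finset.card_insert_le _ _).trans (Nat.succ_le_succ ?_)) m
      refine (Multiset.toFinset_card_le _).trans ?_
      rw [← hp]
      exact hq.card_filter_le hm
  have hH : ∀ p, H p ≤ ∑' s, (if p ∈ {p | Φ p = s ∧ Q p} then 1 else 0) *
      ((m ^ m : ℕ) * (partWeight (Set.Ici 1) s * (if k ∈ rowSums m s then 1 else 0))) := by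
    intro p
    by_cases hq : Q p
    swap
    · simp [H, hq]
    refine le_trans ?_ (ENNReal.le_tsum (Φ p))
    rw [if_pos (show p ∈ {p' | Φ p' = Φ p ∧ Q p'} from ⟨rfl, hq⟩), one_mul,
      if_pos (hq.mem_rowSums hck), mul_one,
      partWeight_of_forall fun j hj => Set.mem_Ici.mpr (hq.one_le_of_mem hc hM' hck hMK hj)]
    simp only [H]
    rw [if_pos hq, ← inv_natCast_prod,
      ← ENNReal.mul_inv (Or.inr (by finiteness)) (Or.inl (by finiteness)),
      ← ENNReal.mul_inv (Or.inr (by finiteness)) (Or.inl (by finiteness))]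
    have h1 := hq.centralizerOrder_le hm hc hM' hck hMK hK
    have hm0 : ((m ^ m : ℕ) : ℝ≥0∞) ≠ 0 := by
      have : m ^ m ≠ 0 := pow_ne_zero _ (by omega)
      exact_mod_cast this
    have h2 : ((m ^ m : ℕ) : ℝ≥0∞)⁻¹ * (((centralizerOrder p.1 : ℕ) : ℝ≥0∞) *
        ((∏ i ∈ Finset.univ.erase last, (k i - p.2.1 i) : ℕ) : ℝ≥0∞) *
        ((centralizerOrder p.2.2 : ℕ) : ℝ≥0∞))⁻¹ ≤ ((centralizerOrder (Φ p) : ℕ) : ℝ≥0∞)⁻¹ := by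
      rw [← ENNReal.mul_inv (Or.inr (by finiteness)) (Or.inl (by finiteness)), ENNReal.inv_le_inv]
      exact_mod_cast h1
    calc _ = ((m ^ m : ℕ) : ℝ≥0∞) * (((m ^ m : ℕ) : ℝ≥0∞)⁻¹ *
          (((centralizerOrder p.1 : ℕ) : ℝ≥0∞) *
          ((∏ i ∈ Finset.univ.erase last, (k i - p.2.1 i) : ℕ) : ℝ≥0∞) *
          ((centralizerOrder p.2.2 : ℕ) : ℝ≥0∞))⁻¹) := by
          rw [← mul_assoc, ENNReal.mul_inv_cancel hm0 (by finiteness), one_mul]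
      _ ≤ _ := by gcongr
  have hupper : ∑' p, H p ≤ (m ^ m * (m + 1) ^ m : ℕ) * T := by
    calc ∑' p, H p ≤ ∑' s, ∑' p, (if p ∈ {p | Φ p = s ∧ Q p} then 1 else 0) *
          ((m ^ m : ℕ) * (partWeight (Set.Ici 1) s * (if k ∈ rowSums m s then 1 else 0))) := by
          rw [ENNReal.tsum_comm]
          exact ENNReal.tsum_le_tsum hH
      _ ≤ ∑' s, (((m + 1) ^ m : ℕ) : ℝ≥0∞) *
          ((m ^ m : ℕ) * (partWeight (Set.Ici 1) s * (if k ∈ rowSums m s then 1 else 0))) := by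
          refine ENNReal.tsum_le_tsum fun s => ?_
          rw [ENNReal.tsum_mul_right, tsum_ite_mem_eq_ncard (hfib s).1]
          gcongr
          exact (hfib s).2
      _ = _ := by
          rw [ENNReal.tsum_mul_left, ENNReal.tsum_mul_left, ← hT]
          push_cast; ring
  have hK0 : ((3 * K : ℕ) : ℝ≥0∞) ≠ 0 := by
    have : 3 * K ≠ 0 := by omega
    exact_mod_cast this
  have hlower : (((3 * K) ^ m : ℕ) : ℝ≥0∞)⁻¹ * ∑' a : Multiset ℕ, partWeight (Set.Icc 1 M) a *
      (numRowSums m a * if 2 * a.sum ≤ c then 1 else 0) ≤ ∑' p, H p := by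
    have h1 : ∀ a v, (if v ∈ rowSums m a then 1 else 0) * ((((3 * K) ^ m : ℕ) : ℝ≥0∞)⁻¹ *
        (partWeight (Set.Icc 1 M) a * if 2 * a.sum ≤ c then 1 else 0)) ≤ ∑' b, H (a, v, b) := by
      intro a v
      by_cases hv : v ∈ rowSums m a
      swap
      · simp [hv]
      by_cases ha : ∀ j ∈ a, j ∈ Set.Icc 1 M
      swap
      · simp [partWeight_of_not ha]
      by_cases hs : 2 * a.sum ≤ c
      swap
      · simp [hs]
      rw [if_pos hv, if_pos hs, one_mul, mul_one, partWeight_of_forall ha]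
      have htail := le_tsum_tail (K := K) (N := k last - v last) (p := fun b => Q (a, v, b))
        fun b hb => ⟨hv, hs, ha, hb⟩
      have hb : (2 * (K : ℝ≥0∞) + 1) ≤ ((3 * K : ℕ) : ℝ≥0∞) := by
        have : 2 * K + 1 ≤ 3 * K := by omega
        exact_mod_cast this
      have hprod : (((3 * K : ℕ) : ℝ≥0∞)⁻¹) ^ (m - 1) ≤
          ∏ i ∈ Finset.univ.erase last, ((k i - v i : ℕ) : ℝ≥0∞)⁻¹ := by
        have hcard : (Finset.univ.erase last).card = m - 1 := by
          rw [Finset.card_erase_of_mem (Finset.mem_univ _), Finset.card_univ, Fintype.card_fin]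
        rw [← hcard, ← Finset.prod_const]
        refine Finset.prod_le_prod' fun i hi => ?_
        rw [ENNReal.inv_le_inv]
        have h1 := hK i (Finset.ne_of_mem_erase hi)
        exact_mod_cast (by omega : k i - v i ≤ 3 * K)
      calc (((3 * K) ^ m : ℕ) : ℝ≥0∞)⁻¹ * ((centralizerOrder a : ℕ) : ℝ≥0∞)⁻¹
          = ((centralizerOrder a : ℕ) : ℝ≥0∞)⁻¹ * ((((3 * K : ℕ) : ℝ≥0∞)⁻¹) ^ (m - 1) *
            ((3 * K : ℕ) : ℝ≥0∞)⁻¹) := by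
            rw [← pow_succ, Nat.sub_add_cancel hm, Nat.cast_pow, ENNReal.inv_pow, mul_comm]
        _ ≤ ((centralizerOrder a : ℕ) : ℝ≥0∞)⁻¹ *
            ((∏ i ∈ Finset.univ.erase last, ((k i - v i : ℕ) : ℝ≥0∞)⁻¹) *
            ∑' b, if Q (a, v, b) then ((centralizerOrder b : ℕ) : ℝ≥0∞)⁻¹ else 0) := by
            gcongr
            exact (ENNReal.inv_le_inv.mpr hb).trans htail
        _ = _ := by
            rw [← mul_assoc, ← ENNReal.tsum_mul_left]
            refine tsum_congr fun b => ?_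
            simp only [H]
            split_ifs <;> simp
    rw [ENNReal.tsum_prod', ← ENNReal.tsum_mul_left]
    refine ENNReal.tsum_le_tsum fun a => ?_
    rw [ENNReal.tsum_prod']
    refine le_trans (le_of_eq ?_) (ENNReal.tsum_le_tsum fun v => h1 a v)
    rw [ENNReal.tsum_mul_right, tsum_ite_mem_eq_ncard (rowSums_finite m a), ← numRowSums]
    ring
  have hKm : (((3 * K) ^ m : ℕ) : ℝ≥0∞) ≠ 0 := by
    rw [Nat.cast_pow]; exact pow_ne_zero _ hK0
  set G := ∑' a : Multiset ℕ, partWeight (Set.Icc 1 M) a *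
      (numRowSums m a * if 2 * a.sum ≤ c then 1 else 0) with hG
  calc smoothSum m M ≤ 2 * G := smoothSum_le_two_mul hc hM
    _ = 2 * (((3 * K) ^ m : ℕ) * ((((3 * K) ^ m : ℕ) : ℝ≥0∞)⁻¹ * G)) := by
        rw [← mul_assoc ((((3 * K) ^ m : ℕ)) : ℝ≥0∞), ENNReal.mul_inv_cancel hKm (by finiteness),
          one_mul]
    _ ≤ 2 * (((3 * K) ^ m : ℕ) * ((m ^ m * (m + 1) ^ m : ℕ) * T)) := by
        exact mul_le_mul_right (mul_le_mul_right (hlower.trans hupper) _) _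
    _ = _ := by push_cast; ring

/-! ### Explicit constants and conclusion -/

/-- The constant in the upper bound for `fixedSetsProportion`. -/
noncomputable def upperConstant (m : ℕ) : ℝ :=
  (m ^ 2 * momentConstant m (2 * m) : ℕ) * Real.exp 1

theorem upperConstant_pos {m : ℕ} (hm : 2 ≤ m) : 0 < upperConstant m := by
  have h1 : 0 < momentConstant m (2 * m) := Finset.prod_pos fun i _ => by positivity
  have h2 : 0 < m ^ 2 * momentConstant m (2 * m) := Nat.mul_pos (by positivity) h1
  exact mul_pos (by exact_mod_cast h2) (Real.exp_pos 1)

theorem fixedSetsProportion_nonneg (n : ℕ) {m : ℕ} (k : Fin m → ℕ) :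
    0 ≤ fixedSetsProportion n k := by
  rw [fixedSetsProportion]; positivity

theorem fixedSetsProportion_le {m : ℕ} (hm : 2 ≤ m) {n : ℕ} {k : Fin m → ℕ}
    (hn : ∑ i, k i = n) {c K : ℕ} (hc : 1 ≤ c) (hck : ∀ i, c ≤ k i) {last : Fin m}
    (hK : ∀ i, i ≠ last → k i ≤ K) (hcK : c ≤ K) {Ω : Type*} [MeasurableSpace Ω] {P : Measure Ω}
    [IsProbabilityMeasure P] {X : Fin c → Ω → ℕ} (hX : IsHarmonicPoisson P X) :
    fixedSetsProportion n k ≤ upperConstant m * (((K : ℝ) / c) ^ m *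
      ((∫ ω, ((sumTuples m fun j => X j ω).ncard : ℝ) ∂P) / (c : ℝ) ^ (m - 1))) := by
  classical
  have hc' : (0 : ℝ) < c := by exact_mod_cast hc
  have h1 := tsum_partWeight_rowSums_le hm hc hck hK hcK
  rw [← ofReal_fixedSetsProportion hn] at h1
  have h2 : fixedSetsProportion n k ≤ (m ^ 2 * momentConstant m (2 * m) : ℕ) * ((c : ℝ) ^ m)⁻¹ *
      (((K : ℝ) / c) ^ m * (smoothSum m c).toReal) := by
    rw [← ENNReal.ofReal_le_ofReal_iff (by positivity)]
    refine (h1.trans (mul_le_mul_right (smoothSum_le_of_le m hc hcK) _)).trans_eq ?_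
    rw [ENNReal.ofReal_mul (by positivity), ENNReal.ofReal_mul (by positivity),
      ENNReal.ofReal_mul (by positivity), ENNReal.ofReal_toReal (smoothSum_ne_top m c),
      ENNReal.ofReal_natCast, ENNReal.ofReal_inv_of_pos (by positivity),
      ENNReal.ofReal_pow hc'.le, ENNReal.ofReal_natCast]
  have h3 := (smoothSum_toReal_bounds hc hX m).2
  set E := ∫ ω, ((sumTuples m fun j => X j ω).ncard : ℝ) ∂P
  have hpow : (c : ℝ) ^ m = (c : ℝ) ^ (m - 1) * c := by
    rw [← pow_succ, Nat.sub_add_cancel (by omega)]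
  calc fixedSetsProportion n k ≤ (m ^ 2 * momentConstant m (2 * m) : ℕ) * ((c : ℝ) ^ m)⁻¹ *
      (((K : ℝ) / c) ^ m * (Real.exp 1 * c * E)) := by
        refine h2.trans ?_
        gcongr
    _ = _ := by
        rw [upperConstant, hpow]
        field_simp

/-- The constant in the lower bound for `fixedSetsProportion`. -/
def lowerConstant (m : ℕ) : ℕ := (12 * m) ^ m * (2 * 3 ^ m * (m ^ m * (m + 1) ^ m))

theorem le_fixedSetsProportion {m : ℕ} (hm : 2 ≤ m) {n : ℕ} {k : Fin m → ℕ}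
    (hn : ∑ i, k i = n) {c K : ℕ} (hc : 1 ≤ c) (hck : ∀ i, c ≤ k i) {last : Fin m}
    (hK : ∀ i, i ≠ last → k i ≤ K) (hcK : c ≤ K) {Ω : Type*} [MeasurableSpace Ω] {P : Measure Ω}
    [IsProbabilityMeasure P] {X : Fin c → Ω → ℕ} (hX : IsHarmonicPoisson P X) :
    (∫ ω, ((sumTuples m fun j => X j ω).ncard : ℝ) ∂P) / (c : ℝ) ^ (m - 1) ≤
      lowerConstant m * ((K : ℝ) / c) ^ m * fixedSetsProportion n k := by
  classical
  have hc' : (0 : ℝ) < c := by exact_mod_cast hc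
  have hi := fixedSetsProportion_nonneg n k
  have hM : 4 * (m * (c / (4 * m))) ≤ c := by
    rw [← mul_assoc]; exact Nat.mul_div_le c (4 * m)
  have h1 := smoothSum_le_tsum_partWeight_rowSums (by omega) hc hM hck hK hcK
  rw [← ofReal_fixedSetsProportion hn] at h1
  have h2 : (smoothSum m c).toReal ≤ lowerConstant m * (K : ℝ) ^ m * fixedSetsProportion n k := by
    refine ENNReal.toReal_le_of_le_ofReal (by positivity)
      (((smoothSum_le_smoothSum_div (by omega) hc).trans (mul_le_mul_right h1 _)).trans_eq ?_)
    rw [ENNReal.ofReal_mul (by positivity), ← mul_assoc]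
    congr 1
    rw [← Nat.cast_pow K, ← Nat.cast_mul, ← Nat.cast_mul, ENNReal.ofReal_natCast]
    congr 1
    rw [lowerConstant, mul_pow]
    ring
  have h3 := (smoothSum_toReal_bounds hc hX m).1
  set E := ∫ ω, ((sumTuples m fun j => X j ω).ncard : ℝ) ∂P
  have hpow : (c : ℝ) ^ m = (c : ℝ) ^ (m - 1) * c := by
    rw [← pow_succ, Nat.sub_add_cancel (by omega)]
  calc E / (c : ℝ) ^ (m - 1) = (c * E) / (c : ℝ) ^ m := by
        rw [hpow]; field_simp
    _ ≤ (lowerConstant m * (K : ℝ) ^ m * fixedSetsProportion n k) / (c : ℝ) ^ m := by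
        exact div_le_div_of_nonneg_right (h3.trans h2) (by positivity)
    _ = _ := by rw [div_pow]; ring

/-- Here `k ⟨0, _⟩` is `k_1` and `k ⟨m - 2, _⟩` is `k_{m-1}`. -/
theorem proposition3p1 (m : ℕ) (hm : 2 ≤ m) :
    (∃ C : ℝ, 0 < C ∧
      ∀ (n : ℕ) (k : Fin m → ℕ), Monotone k → 1 ≤ k ⟨0, by omega⟩ → ∑ i, k i = n →
      ∀ (Ω : Type*) [MeasurableSpace Ω] (P : Measure Ω) [IsProbabilityMeasure P]
        (X : Fin (k ⟨0, by omega⟩) → Ω → ℕ), IsHarmonicPoisson P X →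
        Integrable (fun ω => ((sumTuples m fun j => X j ω).ncard : ℝ)) P ∧
        fixedSetsProportion n k ≤
          C * (((k ⟨m - 2, by omega⟩ : ℝ) / (k ⟨0, by omega⟩ : ℝ)) ^ m *
            ((∫ ω, ((sumTuples m fun j => X j ω).ncard : ℝ) ∂P) /
              (k ⟨0, by omega⟩ : ℝ) ^ (m - 1)))) ∧
    (∀ c : ℝ, ∃ C₁ C₂ : ℝ, 0 < C₁ ∧ 0 < C₂ ∧
      ∀ (n : ℕ) (k : Fin m → ℕ), Monotone k → 1 ≤ k ⟨0, by omega⟩ → ∑ i, k i = n →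
      (k ⟨m - 2, by omega⟩ : ℝ) ≤ c * (k ⟨0, by omega⟩ : ℝ) →
      ∀ (Ω : Type*) [MeasurableSpace Ω] (P : Measure Ω) [IsProbabilityMeasure P]
        (X : Fin (k ⟨0, by omega⟩) → Ω → ℕ), IsHarmonicPoisson P X →
        C₁ * ((∫ ω, ((sumTuples m fun j => X j ω).ncard : ℝ) ∂P) /
              (k ⟨0, by omega⟩ : ℝ) ^ (m - 1)) ≤ fixedSetsProportion n k ∧
        fixedSetsProportion n k ≤
          C₂ * ((∫ ω, ((sumTuples m fun j => X j ω).ncard : ℝ) ∂P) /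
              (k ⟨0, by omega⟩ : ℝ) ^ (m - 1))) := by
  -- The general bounds are applied with `c = k_1`, `K = k_{m-1}` and `last` the index of `k_m`, the
  -- only size allowed to exceed `K`.
  have hbase : ∀ (n : ℕ) (k : Fin m → ℕ), Monotone k →
      (∀ i, k ⟨0, by omega⟩ ≤ k i) ∧
      (∀ i, i ≠ (⟨m - 1, by omega⟩ : Fin m) → k i ≤ k ⟨m - 2, by omega⟩) := by
    intro n k hk
    refine ⟨fun i => hk (Fin.mk_le_of_le_val (Nat.zero_le _)), fun i hi => hk ?_⟩
    have h1 : (i : ℕ) ≠ m - 1 := fun h => hi (Fin.ext h)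
    have h2 := i.isLt
    exact Fin.le_def.mpr (by simp only; omega)
  refine ⟨⟨upperConstant m, upperConstant_pos hm, ?_⟩, fun c => ?_⟩
  · intro n k hk hk1 hn Ω _ P _ X hX
    obtain ⟨h0, hK⟩ := hbase n k hk
    exact ⟨integrable_ncard_sumTuples hX m, fixedSetsProportion_le hm hn hk1 h0 hK (h0 _) hX⟩
  · have hL : (0 : ℝ) < lowerConstant m := by
      have : 0 < lowerConstant m := by rw [lowerConstant]; positivity
      exact_mod_cast this
    have hU := upperConstant_pos hm
    -- Using `|c| + 1` instead of `c` keeps the constants positive for every real `c`.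
    refine ⟨(lowerConstant m * (|c| + 1) ^ m)⁻¹, upperConstant m * (|c| + 1) ^ m,
      by positivity, by positivity, ?_⟩
    intro n k hk hk1 hn hkc Ω _ P _ X hX
    obtain ⟨h0, hK⟩ := hbase n k hk
    have hk0 : (0 : ℝ) < k ⟨0, by omega⟩ := by exact_mod_cast hk1
    have hratio : (k ⟨m - 2, by omega⟩ : ℝ) / k ⟨0, by omega⟩ ≤ |c| + 1 := by
      rw [div_le_iff₀ hk0]
      refine hkc.trans ?_
      gcongr
      linarith [le_abs_self c]
    have hE : 0 ≤ ∫ ω, ((sumTuples m fun j => X j ω).ncard : ℝ) ∂P :=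
      integral_nonneg fun ω => Nat.cast_nonneg _
    constructor
    · rw [inv_mul_le_iff₀ (by positivity)]
      refine (le_fixedSetsProportion hm hn hk1 h0 hK (h0 _) hX).trans ?_
      have := fixedSetsProportion_nonneg n k
      gcongr
    · refine (fixedSetsProportion_le hm hn hk1 h0 hK (h0 _) hX).trans ?_
      rw [mul_assoc]
      gcongr
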